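/- Let $p$ be a prime, let $n\ge 0$ be an integer, let $R=\mathbb{F}_p[x_1,\dots,x_n]$, and let $\mathbf{A}=R\{f\}/(x_i^pf \mid 1\le i\le n)$ be the noncommutative $\mathbb{F}_p$-algebra generated by commuting elements $x_1,\dots,x_n$ and an element $f$ subject only to the further relations $x_i^pf=0$, graded by $\deg x_i=\deg f=1$. Let $N=\bigoplus_{i\in\mathbb{Z}}[N]_i$ be a $\mathbb{Z}$-graded left $\mathbf{A}$-module that is finitely presented over $\mathbf{A}$. Let $$\Theta_N:\bigoplus_{v\in\{0,\dots,p-1\}^n}N\to N$$ be the map that on the summand indexed by $v$ is multiplication by $x^vf=x_1^{v_1}\cdots x_n^{v_n}f$. Its image is an $R$-submodule of $N$; let $C_N=\operatorname{Coker}(\Theta_N)$ be the resulting $R$-module, and let $d=\dim C_N$ be its Krull dimension over $R$ (with the convention $\dim 0=0$). Put $$g_{p,n}(t)=1-t(1+t+\cdots+t^{p-1})^n.$$ Then every $[N]_i$ is finite-dimensional over $\mathbb{F}_p$, $[N]_i=0$ for $i\ll 0$, $0\le d\le n$, and the Hilbert series $\mathrm{HS}_N(t)=\sum_i\dim_{\mathbb{F}_p}([N]_i)\,t^i$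 has the form $$\mathrm{HS}_N(t)=\frac{a(t)}{(1-t)^d\,g_{p,n}(t)}$$ for a Laurent polynomial $a(t)\in\mathbb{Z}[t,t^{-1}]$. No power $t^i$ with $i<k$ occurs in $a(t)$ if $[N]_i=0$ for all $i<k$; in particular, $a(t)\in\mathbb{Z}[t]$ if $N$ has no nonzero component of negative degree. If $d>0$, then $a(1)>0$. -/

import Mathlib

/-!
# Graded modules over the ring `A = 𝔽_p[x_1, …, x_n]{f} / (x_i ^ p f)`
-/

open Polynomial LaurentPolynomial PowerSeries

noncomputable section

namespace FrobGr

/-! ## The ring `A` -/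

/-- The free noncommutative algebra `𝔽_p{x_1, …, x_n, f}`; the generator `x_i` is `Sum.inl i`
and the generator `f` is `Sum.inr ()`. -/
abbrev Free (p n : ℕ) : Type := FreeAlgebra (ZMod p) (Fin n ⊕ Unit)

/-- The defining relations of `A`: the `x_i` commute with each other, and `x_i ^ p f = 0`. -/
inductive Rel (p n : ℕ) : Free p n → Free p n → Prop
  | comm (i j : Fin n) :
      Rel p n (FreeAlgebra.ι (ZMod p) (Sum.inl i) * FreeAlgebra.ι (ZMod p) (Sum.inl j))
        (FreeAlgebra.ι (ZMod p) (Sum.inl j) * FreeAlgebra.ι (ZMod p) (Sum.inl i))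
  | trunc (i : Fin n) :
      Rel p n (FreeAlgebra.ι (ZMod p) (Sum.inl i) ^ p * FreeAlgebra.ι (ZMod p) (Sum.inr ())) 0

/-- The (noncommutative) ring `A = 𝔽_p[x_1, …, x_n]{f} / (x_i ^ p f | 1 ≤ i ≤ n)`. -/
abbrev A (p n : ℕ) : Type := RingQuot (Rel p n)

variable {p n : ℕ}

/-- The images of the generators in `A`. -/
def gen (p n : ℕ) (s : Fin n ⊕ Unit) : A p n :=
  RingQuot.mkAlgHom (ZMod p) (Rel p n) (FreeAlgebra.ι (ZMod p) s)

/-- The element `x_i` of `A`. -/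
def x (p n : ℕ) (i : Fin n) : A p n := gen p n (Sum.inl i)

/-- The element `f` of `A`. -/
def f (p n : ℕ) : A p n := gen p n (Sum.inr ())

theorem x_commute (i j : Fin n) : Commute (x p n i) (x p n j) := by
  have h := RingQuot.mkAlgHom_rel (ZMod p) (Rel.comm (p := p) i j)
  rw [map_mul, map_mul] at h
  exact h

theorem x_pow_mul_f (i : Fin n) : x p n i ^ p * f p n = 0 := by
  have h := RingQuot.mkAlgHom_rel (ZMod p) (Rel.trunc (p := p) i)
  rw [map_mul, map_pow, map_zero] at h
  exact h

/-- The homogeneous component `[A]_i` of the grading with `deg x_j = deg f = 1`: the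
`𝔽_p`-span of all products of `i` generators. -/
def degreePart (p n i : ℕ) : Submodule (ZMod p) (A p n) :=
  Submodule.span (ZMod p) (Set.range (gen p n)) ^ i

/-- The monomial `x ^ v = x_1 ^ v_1 ⋯ x_n ^ v_n` of `A`. -/
def xpow (p n : ℕ) (v : Fin n → ℕ) : A p n :=
  Finset.univ.noncommProd (fun i => x p n i ^ v i)
    (fun i _ j _ _ => (x_commute i j).pow_pow (v i) (v j))

theorem xpow_zero : xpow p n 0 = 1 := by
  exact (Finset.noncommProd_eq_pow_card Finset.univ (fun i => x p n i ^ (0 : Fin n → ℕ) i)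
    (fun i _ j _ _ => (x_commute i j).pow_pow _ _) 1 (fun i _ => by simp)).trans (one_pow _)

theorem xpow_add (v w : Fin n → ℕ) : xpow p n (v + w) = xpow p n v * xpow p n w := by
  unfold xpow
  rw [← Finset.noncommProd_mul_distrib (fun i => x p n i ^ v i) (fun i => x p n i ^ w i)
    (fun i _ j _ _ => (x_commute i j).pow_pow (v i) (v j))
    (fun i _ j _ _ => (x_commute i j).pow_pow (w i) (w j))
    (fun i _ j _ _ => (x_commute i j).pow_pow (w i) (v j))]
  exact Finset.noncommProd_congr rfl (fun i _ => by simp [pow_add]) _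

theorem xpow_mul_f_eq_zero (w : Fin n → ℕ) (i : Fin n) (hi : p ≤ w i) :
    xpow p n w * f p n = 0 := by
  have h1 : xpow p n w = Finset.noncommProd (Finset.univ.erase i) (fun j => x p n j ^ w j)
      (fun i _ j _ _ => (x_commute i j).pow_pow (w i) (w j)) * x p n i ^ w i :=
    (Finset.noncommProd_erase_mul Finset.univ (Finset.mem_univ i) (fun j => x p n j ^ w j)
      (fun i _ j _ _ => (x_commute i j).pow_pow (w i) (w j))).symm
  rw [h1, mul_assoc, ← Nat.sub_add_cancel hi, pow_add, mul_assoc, x_pow_mul_f]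
  simp

/-- The ring homomorphism `R = 𝔽_p[x_1, …, x_n] → A`, `x_i ↦ x_i`. -/
def polyToA (p n : ℕ) : MvPolynomial (Fin n) (ZMod p) →ₐ[ZMod p] A p n :=
  AddMonoidAlgebra.lift (ZMod p) (A p n) (Fin n →₀ ℕ)
    { toFun := fun v => xpow p n (v.toAdd : Fin n →₀ ℕ)
      map_one' := xpow_zero
      map_mul' := fun v w => by
        simpa using xpow_add (p := p) (v.toAdd : Fin n →₀ ℕ) (w.toAdd : Fin n →₀ ℕ) }

theorem polyToA_monomial (v : Fin n →₀ ℕ) (c : ZMod p) :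
    polyToA p n (MvPolynomial.monomial v c) = c • xpow p n v :=
  AddMonoidAlgebra.lift_single _ v c

/-! ## Graded modules and the structure map -/

section Modules

variable (p n) (N : Type*) [AddCommGroup N] [Module (A p n) N]

/-- An `A`-module regarded as an `R`-module by restriction of scalars along `R → A`. -/
abbrev polyModule : Module (MvPolynomial (Fin n) (ZMod p)) N :=
  Module.compHom N (polyToA p n).toRingHom

variable [Module (ZMod p) N] [IsScalarTower (ZMod p) (A p n) N]

/-- `N = ⨁_{i ∈ ℤ} [N]_i` is a graded left module over the graded ring `A`. -/
structure IsGradedModule (𝒩 : ℤ → Submodule (ZMod p) N) : Prop where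
  isInternal : DirectSum.IsInternal 𝒩
  smul_mem : ∀ (i : ℕ) (j : ℤ) (a : A p n) (m : N),
    a ∈ degreePart p n i → m ∈ 𝒩 j → a • m ∈ 𝒩 ((i : ℤ) + j)

/-- The structure map `Θ_N : ⨁_{v ∈ {0, …, p-1}^n} N → N`, equal to multiplication by `x ^ v f`
on the summand with index `v`. -/
def structureMap : ((Fin n → Fin p) → N) →ₗ[ZMod p] N :=
  ∑ v : Fin n → Fin p,
    (Algebra.lsmul (ZMod p) (ZMod p) N (xpow p n (fun i => (v i : ℕ)) * f p n)).comp
      (LinearMap.proj v)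

theorem structureMap_apply (g : (Fin n → Fin p) → N) :
    structureMap p n N g = ∑ v, (xpow p n (fun i => (v i : ℕ)) * f p n) • g v := by
  simp [structureMap, mul_smul]

theorem xpow_f_smul_mem (w : Fin n → ℕ) (m : N) :
    (xpow p n w * f p n) • m ∈ LinearMap.range (structureMap p n N) := by
  by_cases h : ∃ i, p ≤ w i
  · obtain ⟨i, hi⟩ := h
    rw [xpow_mul_f_eq_zero w i hi, zero_smul]
    exact zero_mem _
  · push Not at h
    refine ⟨Pi.single (fun i => ⟨w i, h i⟩) m, ?_⟩
    rw [structureMap_apply, Finset.sum_eq_single (fun i => (⟨w i, h i⟩ : Fin p))]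
    · simp
    · intro v _ hv
      rw [Pi.single_eq_of_ne hv, smul_zero]
    · simp

/-- The image of `Θ_N`, which is an `R`-submodule of `N`. -/
def structureImage :
    letI := polyModule p n N
    Submodule (MvPolynomial (Fin n) (ZMod p)) N :=
  letI := polyModule p n N
  { (LinearMap.range (structureMap p n N)).toAddSubmonoid with
    smul_mem' := by
      rintro r _ ⟨g, rfl⟩
      change polyToA p n r • structureMap p n N g ∈ LinearMap.range (structureMap p n N)
      rw [structureMap_apply, Finset.smul_sum]
      refine Submodule.sum_mem _ fun v _ => ?_
      induction r using MvPolynomial.induction_on' with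
      | monomial u c =>
        rw [polyToA_monomial, smul_assoc, ← mul_smul, ← mul_assoc, ← xpow_add]
        exact Submodule.smul_mem _ _ (xpow_f_smul_mem p n N _ _)
      | add q r hq hr =>
        rw [map_add, add_smul]
        exact add_mem hq hr }

/-- The structural cokernel `C_N = Coker Θ_N`. -/
def StructuralCokernel : Type _ :=
  letI := polyModule p n N
  N ⧸ structureImage p n N

instance : AddCommGroup (StructuralCokernel p n N) :=
  letI := polyModule p n N
  inferInstanceAs (AddCommGroup (N ⧸ structureImage p n N))

/-- The `R`-module structure on `C_N`, where `R = 𝔽_p[x_1, …, x_n]`. -/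
instance : Module (MvPolynomial (Fin n) (ZMod p)) (StructuralCokernel p n N) :=
  letI := polyModule p n N
  inferInstanceAs (Module (MvPolynomial (Fin n) (ZMod p)) (N ⧸ structureImage p n N))

/-- `d` is the Krull dimension of the `R`-module `C_N`, where the zero module is given the
dimension `0` (in `Module.supportDim` its dimension is `⊥`). -/
def IsDimCokernel (d : ℕ) : Prop :=
  (Module.supportDim (MvPolynomial (Fin n) (ZMod p)) (StructuralCokernel p n N)).unbotD 0
    = (d : ℕ∞)

end Modules

/-! ## Hilbert series -/

/-- `H` is the Hilbert series `∑_i dim [N]_i t ^ i`. This includes that all components `[N]_i` are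
finite-dimensional, and, `H` being a formal Laurent series, that `[N]_i = 0` for `i ≪ 0`. -/
structure IsHilbertSeries {p : ℕ} {N : Type*} [AddCommGroup N] [Module (ZMod p) N]
    (𝒩 : ℤ → Submodule (ZMod p) N) (H : LaurentSeries ℤ) : Prop where
  finite : ∀ i, Module.Finite (ZMod p) (𝒩 i)
  coeff_eq : ∀ i, H.coeff i = (Module.finrank (ZMod p) (𝒩 i) : ℤ)

/-- The polynomial `g_{p,n}(t) = 1 - t (1 + t + ⋯ + t ^ (p-1)) ^ n`. -/
def gPoly (p n : ℕ) : ℤ[X] :=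
  1 - Polynomial.X * (∑ i ∈ Finset.range p, Polynomial.X ^ i) ^ n

/-- The inclusion of polynomials into formal Laurent series. A polynomial with constant term `1`,
such as `(1 - t) ^ d g_{p,n}(t)`, becomes a unit of `ℤ((t))`, so that dividing by it amounts to
moving it to the other side as a factor. -/
def polyToSeries (q : ℤ[X]) : LaurentSeries ℤ := ((q : ℤ⟦X⟧) : LaurentSeries ℤ)

/-- The inclusion of Laurent polynomials `∑ c_i t ^ i` into formal Laurent series. -/
def laurentToSeries (a : ℤ[T;T⁻¹]) : LaurentSeries ℤ :=
  ∑ i ∈ a.coeff.support, HahnSeries.single i (a.coeff i)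

end FrobGr

end

open Polynomial LaurentPolynomial PowerSeries

noncomputable section

namespace FrobGr

/-! ## Krull dimension and Noether normalization -/

/-! Expanding the power gives g(t) = 1 - ∑_v t^(|v|+1), and |v|+1 is the degree of x^v f. So g(t)
HS_N(t) compares N with the source of Θ_N, and the exact sequence 0 → ker Θ_N → ⨁_v N(-|v|-1) → N →
C_N → 0 shows that g · HS_N and HS_{C_N} differ by a Laurent polynomial as soon as ker Θ_N is
finite-dimensional. Two things remain.

Finiteness of the kernel (`finiteDimensional_ker_structureMap`). Take a presentation 0 → K → F → N →
0 with F free of finite rank and K finitely generated. Letting A act on R ⊕ ⨁_v A shows that Θ_A,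
hence Θ_F, is injective (`boxSum_injective`). A snake argument then embeds ker Θ_N in C_K, and the
image is killed by every x_i^p because x_i^p f = 0. Since f acts as zero on cokernels, C_K is a
finitely generated R-module; the part of it killed by all x_i^p is finitely generated and hence
finite-dimensional.

The pole of HS_{C_N} at 1 (`exists_hilbert_numerator`). The Hilbert-Serre induction gives the
denominator (1-t)^n. The exact order is read off from growth: a Noether normalization k[y_1, …, y_d]
of R / Ann C, which need not respect the grading, bounds the total dimension in degrees up to m from
above and, after a linear change of m, from below by multiples of m^d. So the Hilbert polynomial of
these totals has degree d, the numerator over (1-t)^n vanishes at 1 to order exactly n-d, and the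
reduced numerator b satisfies b(1) > 0.

Hence a(t) is, up to a power of t, b(t) + (1-t)^d q(t) for a polynomial q, and a(1) = b(1) > 0 when
d > 0. -/

theorem ringKrullDim_eq_of_isIntegral_of_injective {R S : Type*} [CommRing R] [CommRing S]
    [Algebra R S] [Algebra.IsIntegral R S] (hinj : Function.Injective (algebraMap R S)) :
    ringKrullDim S = ringKrullDim R := by
  apply le_antisymm
  · exact Order.krullDim_le_of_strictMono (PrimeSpectrum.comap (algebraMap R S))
      fun P Q h => Ideal.IsIntegral.comap_lt_comap (R := R) h
  · refine iSup_le fun l => ?_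
    obtain ⟨Q, -, hQ, hQl⟩ := Ideal.exists_ideal_over_prime_of_isIntegral
      (S := S) (RelSeries.head l).asIdeal ⊥ (by
        rw [← RingHom.ker_eq_comap_bot, (RingHom.injective_iff_ker_eq_bot _).1 hinj]
        exact bot_le)
    have : Q.LiesOver (RelSeries.head l).asIdeal := ⟨hQl.symm⟩
    obtain ⟨L, hL, -⟩ := Ideal.exists_ltSeries_of_hasGoingUp l Q
    rw [← hL]
    exact le_iSup (fun p : LTSeries (PrimeSpectrum S) => (p.length : WithBot ℕ∞)) L

theorem exists_fun_of_finite {B S : Type*} [CommRing B] [CommRing S] {g : B →+* S}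
    (hg : g.Finite) : ∃ (m : ℕ) (v : Fin m → S), ∀ s, ∃ b : Fin m → B, s = ∑ j, g (b j) * v j := by
  algebraize [g]
  obtain ⟨m, v, hv⟩ := Module.Finite.exists_fin (R := B) (M := S)
  refine ⟨m, v, fun s => ?_⟩
  obtain ⟨b, hb⟩ := (Submodule.mem_span_range_iff_exists_fun B).1 (hv ▸ Submodule.mem_top : s ∈ _)
  exact ⟨b, by rw [← hb]; exact Finset.sum_congr rfl fun j _ => Algebra.smul_def _ _⟩

/-- Normalize R / Ann C and lift the map to R, which is possible because its source is a polynomial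
ring. The free element and the finite generating family are the only traces of the dimension that
the growth estimates use. -/
theorem exists_noether_normalization_module {k : Type*} [Field k] {n : ℕ} (C : Type*)
    [AddCommGroup C] [Module (MvPolynomial (Fin n) k) C] [Nontrivial C]
    [Module.Finite (MvPolynomial (Fin n) k) C] :
    ∃ d ≤ n, Module.supportDim (MvPolynomial (Fin n) k) C = (d : ℕ∞) ∧
      ∃ φ : MvPolynomial (Fin d) k →ₐ[k] MvPolynomial (Fin n) k,
        (∃ c : C, ∀ b, φ b • c = 0 → b = 0) ∧
        ∃ (r : ℕ) (e : Fin r → C), ∀ c, ∃ b : Fin r → MvPolynomial (Fin d) k,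
          c = ∑ j, φ (b j) • e j := by
  set R := MvPolynomial (Fin n) k
  set I := Module.annihilator R C
  have hI : I ≠ ⊤ := fun h => by
    have : Subsingleton C := Module.annihilator_eq_top_iff.1 h
    exact not_subsingleton C this
  obtain ⟨d, hd, g, hg, hint⟩ := exists_integral_inj_algHom_of_quotient I hI
  obtain ⟨φ, hφ⟩ : ∃ φ : MvPolynomial (Fin d) k →ₐ[k] R, ∀ b, Ideal.Quotient.mk I (φ b) = g b := by
    choose y hy using fun i => Ideal.Quotient.mk_surjective (g (MvPolynomial.X i))
    refine ⟨MvPolynomial.aeval y, fun b => ?_⟩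
    have : (Ideal.Quotient.mkₐ k I).comp (MvPolynomial.aeval y) = g := by
      ext i
      simp [hy]
    exact DFunLike.congr_fun this b
  refine ⟨d, hd, ?_, φ, ?_, ?_⟩
  · rw [Module.supportDim_eq_ringKrullDim_quotient_annihilator]
    let := g.toRingHom.toAlgebra
    have : Algebra.IsIntegral (MvPolynomial (Fin d) k) (R ⧸ I) := ⟨hint⟩
    rw [ringKrullDim_eq_of_isIntegral_of_injective (R := MvPolynomial (Fin d) k) hg,
      MvPolynomial.ringKrullDim_of_isNoetherianRing]
    simp
  · obtain ⟨s, hs⟩ := (Module.Finite.fg_top : (⊤ : Submodule R C).FG)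
    -- If every element had a nonzero annihilator, the product of those of a finite generating set
    -- would be nonzero and act as zero on C, against the injectivity of `g`.
    by_contra! hc
    choose b hb hb0 using hc
    have h0 : ∏ c ∈ s, b c ≠ 0 := Finset.prod_ne_zero_iff.2 fun c _ => hb0 c
    apply h0
    apply hg
    rw [map_zero, ← hφ, Ideal.Quotient.eq_zero_iff_mem]
    have : I = (Submodule.span R (s : Set C)).annihilator := by
      rw [hs, Submodule.annihilator_top]
    rw [this, Submodule.mem_annihilator_span]
    rintro ⟨c, hc⟩
    obtain ⟨q, hq⟩ := Finset.dvd_prod_of_mem b hc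
    change φ _ • c = 0
    rw [hq, mul_comm, map_mul, mul_smul, hb, smul_zero]
  · have hfin : g.toRingHom.Finite := by
      refine hint.to_finite (RingHom.FiniteType.of_comp_finiteType
        (f := algebraMap k (MvPolynomial (Fin d) k)) ?_)
      have : g.toRingHom.comp (algebraMap k (MvPolynomial (Fin d) k)) = algebraMap k (R ⧸ I) :=
        RingHom.ext g.commutes
      rw [this]
      exact RingHom.finiteType_algebraMap.2 inferInstance
    obtain ⟨m, v, hv⟩ := exists_fun_of_finite hfin
    obtain ⟨t, ht⟩ := (Module.Finite.fg_top : (⊤ : Submodule R C).FG)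
    choose lift hlift using Ideal.Quotient.mk_surjective (I := I)
    let E : Fin m × t → C := fun q => lift (v q.1) • (q.2 : C)
    have key : ∀ c : C, ∃ b : Fin m × t → MvPolynomial (Fin d) k, c = ∑ q, φ (b q) • E q := by
      intro c
      have hc : c ∈ Submodule.span R (Set.range ((↑) : t → C)) := by
        rw [Subtype.range_coe_subtype]; erw [ht]; trivial
      obtain ⟨a, ha⟩ := (Submodule.mem_span_range_iff_exists_fun R).1 hc
      have ha' := fun u : t => hv (Ideal.Quotient.mk I (a u))
      choose b hb using ha'
      refine ⟨fun q => b q.2 q.1, ?_⟩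
      rw [← ha, Fintype.sum_prod_type_right]
      refine Finset.sum_congr rfl fun u _ => ?_
      have hmem : a u - ∑ q, φ (b u q) * lift (v q) ∈ I := by
        rw [← Ideal.Quotient.eq_zero_iff_mem, map_sub, map_sum, hb u, sub_eq_zero]
        refine Finset.sum_congr rfl fun q _ => ?_
        rw [map_mul, hφ, hlift]
        rfl
      have := Module.mem_annihilator.1 hmem (u : C)
      rw [sub_smul, sub_eq_zero] at this
      rw [this, Finset.sum_smul]
      exact Finset.sum_congr rfl fun q _ => by rw [mul_smul]
    refine ⟨_, E ∘ (Fintype.equivFin (Fin m × t)).symm, fun c => ?_⟩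
    obtain ⟨b, hb⟩ := key c
    refine ⟨b ∘ (Fintype.equivFin (Fin m × t)).symm, hb.trans ?_⟩
    exact ((Fintype.equivFin (Fin m × t)).symm.sum_comp (fun q => φ (b q) • E q)).symm

/-! ## Pole orders of rational generating functions -/

theorem coeff_succ_of_one_sub_X_mul {F G : ℤ⟦X⟧} (h : (1 - PowerSeries.X) * F = G) (m : ℕ) :
    PowerSeries.coeff (m + 1) F = PowerSeries.coeff m F + PowerSeries.coeff (m + 1) G := by
  rw [← h, sub_mul, one_mul, map_sub, PowerSeries.coeff_succ_X_mul]
  ring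

theorem coeff_eq_sum_of_one_sub_X_mul {F G : ℤ⟦X⟧} (h : (1 - PowerSeries.X) * F = G) (m : ℕ) :
    PowerSeries.coeff m F = ∑ j ∈ Finset.range (m + 1), PowerSeries.coeff j G := by
  induction m with
  | zero => simp [← h, sub_mul]
  | succ m ih => rw [Finset.sum_range_succ, ← ih, coeff_succ_of_one_sub_X_mul h]

theorem one_sub_X_mul_mk_sum (h : ℕ → ℤ) :
    (1 - PowerSeries.X) * PowerSeries.mk (fun m => ∑ j ∈ Finset.range (m + 1), h j) =
      PowerSeries.mk h := by
  ext m
  cases m with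
  | zero => simp [sub_mul]
  | succ m =>
    rw [sub_mul, one_mul, map_sub, PowerSeries.coeff_succ_X_mul, PowerSeries.coeff_mk,
      PowerSeries.coeff_mk, PowerSeries.coeff_mk, Finset.sum_range_succ _ (m + 1)]
    ring

/-- For a simple pole the coefficients are partial sums of b and stabilize at b(1). Each further
factor 1 - X takes differences: once these are at most -1, the coefficients decrease without bound.
-/
theorem eventually_coeff_neg (d : ℕ) {F : ℤ⟦X⟧} {b : ℤ[X]}
    (h : (1 - PowerSeries.X) ^ (d + 1) * F = (b : ℤ⟦X⟧)) (hb : b.eval 1 < 0) :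
    ∃ M, ∀ m ≥ M, PowerSeries.coeff m F < 0 := by
  induction d generalizing F with
  | zero =>
    refine ⟨b.natDegree, fun m hm => ?_⟩
    rw [zero_add, pow_one] at h
    rw [coeff_eq_sum_of_one_sub_X_mul h]
    rw [Polynomial.eval_eq_sum_range' (Nat.lt_succ_of_le hm)] at hb
    simpa using hb
  | succ d ih =>
    rw [pow_succ, mul_assoc] at h
    obtain ⟨M, hM⟩ := ih h
    have key : ∀ t : ℕ, PowerSeries.coeff (M + t) F ≤ PowerSeries.coeff M F - t := by
      intro t
      induction t with
      | zero => simp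
      | succ t iht =>
        rw [← add_assoc, coeff_succ_of_one_sub_X_mul rfl]
        have := hM (M + t + 1) (by lia)
        push_cast
        lia
    refine ⟨M + (PowerSeries.coeff M F).toNat + 1, fun m hm => ?_⟩
    have := key (m - M)
    rw [Nat.add_sub_cancel' (by lia)] at this
    have h1 := Int.self_le_toNat (PowerSeries.coeff M F)
    lia

theorem eval_one_nonneg (d : ℕ) {h : ℕ → ℤ} (hh : ∀ m, 0 ≤ h m) {b : ℤ[X]}
    (hb : (1 - PowerSeries.X) ^ d * PowerSeries.mk h = (b : ℤ⟦X⟧)) : 0 ≤ b.eval 1 := by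
  by_contra! hneg
  -- Passing to partial sums raises the exponent to d + 1, so the case d = 0 is covered too.
  rw [← one_sub_X_mul_mk_sum, ← mul_assoc, ← pow_succ] at hb
  obtain ⟨M, hM⟩ := eventually_coeff_neg d hb hneg
  have := hM M le_rfl
  rw [PowerSeries.coeff_mk] at this
  exact this.not_ge (Finset.sum_nonneg fun j _ => hh j)

open Filter Topology in
-- A quotient of polynomials with smaller degree on top tends to 0, which contradicts the upper
-- bound if deg P > d and the lower bound if deg P < d. The substitution m ↦ Am + B preserves the
-- degree as A > 0.
theorem natDegree_eq_of_growth {P : ℚ[X]} {U : ℕ → ℤ} {d A B c M : ℕ} (hA : 0 < A)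
    (hmono : Monotone U) (hP : ∀ m > M, (U m : ℚ) = P.eval (m : ℚ))
    (hlow : ∀ m : ℕ, (m : ℤ) ^ d ≤ U (A * m + B)) (hup : ∀ m : ℕ, U m ≤ c * (m + 1) ^ d) :
    P ≠ 0 ∧ P.natDegree = d := by
  have hpos : ∀ m ≥ A + B, (1 : ℤ) ≤ U m := fun m hm => by
    have := hlow 1
    simp only [Nat.cast_one, one_pow, mul_one] at this
    exact this.trans (hmono hm)
  have hP0 : P ≠ 0 := by
    rintro rfl
    have h1 := hpos (M + 1 + A + B) (by lia)
    have h2 := hP (M + 1 + A + B) (by lia)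
    rw [Polynomial.eval_zero] at h2
    norm_cast at h2
    lia
  refine ⟨hP0, le_antisymm ?_ ?_⟩
  · by_contra! hlt
    set Q : ℚ[X] := Polynomial.C (c : ℚ) * (Polynomial.X + 1) ^ d with hQ
    have hQd : Q.degree < P.degree := by
      refine lt_of_le_of_lt (Polynomial.degree_mul_le_of_le Polynomial.degree_C_le le_rfl) ?_
      rw [zero_add]
      rw [← Polynomial.C_1, Polynomial.degree_pow, Polynomial.degree_X_add_C,
        Polynomial.degree_eq_natDegree hP0]
      simpa using hlt
    have ht := (Polynomial.div_tendsto_atTop_zero_of_degree_lt _ _ hQd).comp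
      (tendsto_natCast_atTop_atTop (R := ℚ))
    have h1 : ∀ᶠ m : ℕ in atTop, Q.eval (m : ℚ) / P.eval (m : ℚ) < 1 :=
      ht.eventually_lt_const one_pos
    obtain ⟨m, hm, hm'⟩ := (h1.and (eventually_ge_atTop (M + 1 + A + B))).exists
    rw [← hP m (by lia)] at hm
    have h2 : (1 : ℚ) ≤ U m := by exact_mod_cast hpos m (by lia)
    rw [div_lt_one (by linarith)] at hm
    have h3 : (U m : ℚ) ≤ c * (m + 1) ^ d := by exact_mod_cast hup m
    simp [hQ] at hm
    linarith
  · by_contra! hlt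
    set Q : ℚ[X] := P.comp (Polynomial.C (A : ℚ) * Polynomial.X + Polynomial.C (B : ℚ)) with hQ
    have hQd : Q.degree < (Polynomial.X ^ d : ℚ[X]).degree := by
      rw [Polynomial.degree_X_pow]
      refine lt_of_le_of_lt Polynomial.degree_le_natDegree ?_
      rw [Polynomial.natDegree_comp, Polynomial.natDegree_linear (by positivity), mul_one]
      exact_mod_cast hlt
    have ht := (Polynomial.div_tendsto_atTop_zero_of_degree_lt _ _ hQd).comp
      (tendsto_natCast_atTop_atTop (R := ℚ))
    have h1 : ∀ᶠ m : ℕ in atTop, Q.eval (m : ℚ) / (Polynomial.X ^ d : ℚ[X]).eval (m : ℚ) < 1 :=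
      ht.eventually_lt_const one_pos
    obtain ⟨m, hm, hm'⟩ := (h1.and (eventually_ge_atTop (M + 1))).exists
    have h4 : A * m ≥ m := Nat.le_mul_of_pos_left m hA
    have h2 : Q.eval (m : ℚ) = U (A * m + B) := by
      rw [hP _ (by lia)]
      simp [hQ]
    have h3 : (m : ℚ) ^ d ≤ U (A * m + B) := by exact_mod_cast hlow m
    have hm0 : (0 : ℚ) < m := by exact_mod_cast (by lia : 0 < m)
    rw [h2, Polynomial.eval_pow, Polynomial.eval_X, div_lt_one (by positivity)] at hm
    linarith

/-- The partial sums have generating series q / (1-X)^(n+1), so their Hilbert polynomial has degree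
n minus the multiplicity of 1 as a root of q. By growth that degree is d, and (1-X)^(n-d) cancels
exactly. -/
theorem exists_numerator_of_growth {n d A B c : ℕ} (hA : 0 < A) (hd : d ≤ n) {h : ℕ → ℤ}
    (hh : ∀ m, 0 ≤ h m) {q : ℤ[X]}
    (hq : (1 - PowerSeries.X) ^ n * PowerSeries.mk h = (q : ℤ⟦X⟧))
    (hlow : ∀ m : ℕ, (m : ℤ) ^ d ≤ ∑ j ∈ Finset.range (A * m + B + 1), h j)
    (hup : ∀ m : ℕ, ∑ j ∈ Finset.range (m + 1), h j ≤ c * (m + 1) ^ d) :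
    ∃ b : ℤ[X], (1 - PowerSeries.X) ^ d * PowerSeries.mk h = (b : ℤ⟦X⟧) ∧ 0 < b.eval 1 := by
  set U : ℕ → ℤ := fun m => ∑ j ∈ Finset.range (m + 1), h j with hU
  set p : ℚ[X] := q.map (Int.castRingHom ℚ) with hp
  have hmono : Monotone U := monotone_nat_of_le_succ fun m => by
    simp only [hU]
    rw [Finset.sum_range_succ _ (m + 1)]
    linarith [hh (m + 1)]
  have hser : PowerSeries.mk (fun m => (U m : ℚ)) = p * (invOneSubPow ℚ (n + 1) : ℚ⟦X⟧) := by
    have hZ : (1 - PowerSeries.X) ^ (n + 1) * PowerSeries.mk U = (q : ℤ⟦X⟧) := by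
      rw [pow_succ, mul_assoc, hU, one_sub_X_mul_mk_sum, hq]
    have hQ := congrArg (PowerSeries.map (Int.castRingHom ℚ)) hZ
    have hmk : PowerSeries.map (Int.castRingHom ℚ) (PowerSeries.mk U) =
        PowerSeries.mk (fun m => (U m : ℚ)) := by
      ext m
      simp
    rw [map_mul, map_pow, map_sub, map_one, PowerSeries.map_X, ← Polynomial.polynomial_map_coe,
      hmk] at hQ
    have hinv : (1 - PowerSeries.X) ^ (n + 1) * (invOneSubPow ℚ (n + 1) : ℚ⟦X⟧) = 1 :=
      (invOneSubPow ℚ (n + 1)).inv_val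
    rw [← hQ, mul_right_comm, hinv, one_mul]
  have hP : ∀ m > p.natDegree, (U m : ℚ) = (hilbertPoly p (n + 1)).eval (m : ℚ) := fun m hm => by
    rw [← coeff_mul_invOneSubPow_eq_hilbertPoly_eval (n + 1) hm, ← hser, PowerSeries.coeff_mk]
  obtain ⟨hP0, hdeg⟩ := natDegree_eq_of_growth hA hmono hP hlow hup
  have hp0 : p ≠ 0 := by
    intro h0
    exact hP0 (by rw [h0, hilbertPoly_zero_left])
  have hlt : p.rootMultiplicity 1 < n + 1 := by
    by_contra! hge
    exact hP0 (hilbertPoly_eq_zero_of_le_rootMultiplicity_one hge)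
  rw [natDegree_hilbertPoly_of_ne_zero hP0] at hdeg
  have hq0 : q ≠ 0 := by
    rintro rfl
    exact hp0 (by simp [hp])
  have hmult : q.rootMultiplicity 1 = n - d := by
    have := Polynomial.eq_rootMultiplicity_map (p := q) (f := Int.castRingHom ℚ)
      (Int.castRingHom ℚ).injective_int 1
    rw [map_one] at this
    lia
  obtain ⟨q', hq', hnd⟩ := Polynomial.exists_eq_pow_rootMultiplicity_mul_and_not_dvd q hq0 1
  rw [hmult] at hq'
  have hb : (1 - PowerSeries.X) ^ d * PowerSeries.mk h =
      (((-1) ^ (n - d) * q' : ℤ[X]) : ℤ⟦X⟧) := by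
    have hne : (1 - PowerSeries.X : ℤ⟦X⟧) ^ (n - d) ≠ 0 := by
      refine pow_ne_zero _ fun h0 => ?_
      have := congrArg (PowerSeries.coeff 0) h0
      simp at this
    apply mul_left_cancel₀ hne
    rw [← mul_assoc, ← pow_add, Nat.sub_add_cancel hd, hq, hq']
    have h1 : (Polynomial.X - Polynomial.C 1 : ℤ[X]) = -1 * (1 - Polynomial.X) := by
      rw [Polynomial.C_1]; ring
    rw [h1, mul_pow]
    push_cast
    ring
  -- Nonnegative coefficients give b(1) ≥ 0; equality would make X - 1 divide `q'`, from which the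
  -- full power has been removed.
  refine ⟨_, hb, lt_of_le_of_ne (eval_one_nonneg d hh hb) fun h0 => hnd ?_⟩
  rw [Polynomial.dvd_iff_isRoot, Polynomial.IsRoot]
  simpa using h0.symm

/-! ## Growth of filtered modules over polynomial rings -/

section Growth

variable {k : Type*} [Field k] {n : ℕ} {C : Type*} [AddCommGroup C] [Module k C]
  [Module (MvPolynomial (Fin n) k) C]
  {Fil : ℕ → Submodule k C}

theorem monomial_smul_mem_filtration
    (hx : ∀ i m, ∀ c ∈ Fil m, (MvPolynomial.X i : MvPolynomial (Fin n) k) • c ∈ Fil (m + 1))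
    (s : Fin n →₀ ℕ) {m : ℕ} {c : C} (hc : c ∈ Fil m) :
    (MvPolynomial.monomial s (1 : k)) • c ∈ Fil (m + s.degree) := by
  induction s using Finsupp.induction_linear generalizing m c with
  | zero => simpa using hc
  | add s t hs ht =>
    have h1 : MvPolynomial.monomial (s + t) (1 : k) =
        MvPolynomial.monomial s 1 * MvPolynomial.monomial t 1 := by
      rw [MvPolynomial.monomial_mul, one_mul]
    rw [h1, mul_smul, map_add, add_comm s.degree, ← add_assoc]
    exact hs (ht hc)
  | single i e =>
    rw [← MvPolynomial.X_pow_eq_monomial, Finsupp.degree_single]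
    induction e with
    | zero => simpa using hc
    | succ e ih =>
      rw [pow_succ', mul_smul, ← add_assoc]
      exact hx i _ _ ih

variable [IsScalarTower k (MvPolynomial (Fin n) k) C]

theorem smul_mem_filtration (hmono : Monotone Fil)
    (hx : ∀ i m, ∀ c ∈ Fil m, (MvPolynomial.X i : MvPolynomial (Fin n) k) • c ∈ Fil (m + 1))
    (a : MvPolynomial (Fin n) k) {m D : ℕ} (hD : a.totalDegree ≤ D) {c : C} (hc : c ∈ Fil m) :
    a • c ∈ Fil (m + D) := by
  rw [a.as_sum, Finset.sum_smul]
  refine Submodule.sum_mem _ fun s hs => ?_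
  have h1 : MvPolynomial.monomial s (a.coeff s) = a.coeff s • MvPolynomial.monomial s (1 : k) := by
    rw [MvPolynomial.smul_monomial, smul_eq_mul, mul_one]
  rw [h1, smul_assoc]
  refine Submodule.smul_mem _ _ (hmono ?_ (monomial_smul_mem_filtration hx s hc))
  have := MvPolynomial.le_totalDegree hs
  rw [Finsupp.degree_eq_sum]
  rw [Finsupp.sum_fintype _ _ (fun _ => rfl)] at this
  lia

/-- The m^d monomials with all exponents below m stay independent when applied to the free element
c, and they move c by a number of filtration steps linear in m. -/
theorem pow_le_finrank_filtration (hmono : Monotone Fil)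
    (hx : ∀ i m, ∀ c ∈ Fil m, (MvPolynomial.X i : MvPolynomial (Fin n) k) • c ∈ Fil (m + 1))
    (htop : ∀ c, ∃ m, c ∈ Fil m) (hfin : ∀ m, FiniteDimensional k (Fil m)) {d : ℕ}
    (φ : MvPolynomial (Fin d) k →ₐ[k] MvPolynomial (Fin n) k) {c : C}
    (hc : ∀ b, φ b • c = 0 → b = 0) :
    ∃ A B : ℕ, 0 < A ∧ ∀ m : ℕ, m ^ d ≤ Module.finrank k (Fil (A * m + B)) := by
  obtain ⟨B, hB⟩ := htop c
  set D := ∑ l, (φ (MvPolynomial.X l)).totalDegree with hD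
  -- Such a monomial maps under φ to total degree at most dDm; the extra 1 keeps the slope positive
  -- when dD = 0.
  refine ⟨d * D + 1, B, by lia, fun m => ?_⟩
  let L : MvPolynomial (Fin d) k →ₗ[k] C :=
    (LinearMap.toSpanSingleton (MvPolynomial (Fin n) k) C c).restrictScalars k ∘ₗ φ.toLinearMap
  have hL : Function.Injective L := (injective_iff_map_eq_zero L).2 hc
  let v : (Fin d → Fin m) → Fin d →₀ ℕ := fun w => Finsupp.equivFunOnFinite.symm fun l => w l
  have hv : Function.Injective v := fun w w' h => by
    funext l
    exact Fin.ext (DFunLike.congr_fun h l)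
  have hli : LinearIndependent k fun w => L (MvPolynomial.monomial (v w) 1) := by
    have := (MvPolynomial.basisMonomials (Fin d) k).linearIndependent.comp v hv
    have := this.map' L (LinearMap.ker_eq_bot.2 hL)
    simpa [Function.comp_def] using this
  have hcard := finrank_span_eq_card hli
  rw [Fintype.card_fun, Fintype.card_fin, Fintype.card_fin] at hcard
  rw [← hcard]
  refine Submodule.finrank_mono (Submodule.span_le.2 ?_)
  rintro _ ⟨w, rfl⟩
  refine hmono ?_ (smul_mem_filtration (D := d * D * m) hmono hx
    (φ (MvPolynomial.monomial (v w) 1)) ?_ hB)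
  · lia
  · rw [MvPolynomial.monomial_eq, map_mul, map_one, map_one, one_mul,
      Finsupp.prod_fintype _ _ (fun _ => pow_zero _), map_prod]
    refine (MvPolynomial.totalDegree_finsetProd _ _).trans ?_
    calc _ ≤ ∑ l : Fin d, D * m := Finset.sum_le_sum fun l _ => ?_
      _ = _ := by simp [mul_assoc]
    rw [map_pow]
    refine (MvPolynomial.totalDegree_pow _ _).trans ?_
    rw [mul_comm]
    refine Nat.mul_le_mul ?_ (w l).2.le
    exact Finset.single_le_sum (f := fun l => (φ (MvPolynomial.X l)).totalDegree)
      (fun _ _ => Nat.zero_le _) (Finset.mem_univ l)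

theorem finrank_restrictDegree_le (d m : ℕ) :
    Module.finrank k (MvPolynomial.restrictDegree (Fin d) k m) ≤ (m + 1) ^ d := by
  let v : (Fin d → Fin (m + 1)) → MvPolynomial (Fin d) k := fun w =>
    MvPolynomial.monomial (Finsupp.equivFunOnFinite.symm fun l => (w l : ℕ)) 1
  have hle : MvPolynomial.restrictDegree (Fin d) k m ≤ Submodule.span k (Set.range v) := by
    intro b hb
    rw [MvPolynomial.mem_restrictDegree] at hb
    rw [b.as_sum]
    refine Submodule.sum_mem _ fun s hs => ?_
    have h1 : MvPolynomial.monomial s (b.coeff s) = b.coeff s • MvPolynomial.monomial s (1 : k) := by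
      rw [MvPolynomial.smul_monomial, smul_eq_mul, mul_one]
    rw [h1]
    refine Submodule.smul_mem _ _ (Submodule.subset_span
      ⟨fun l => ⟨s l, Nat.lt_succ_of_le (hb s hs l)⟩, ?_⟩)
    simp only [v]
    congr 1
    ext l
    simp
  have := FiniteDimensional.span_of_finite k (Set.finite_range v)
  refine (Submodule.finrank_mono hle).trans ((finrank_range_le_card v).trans ?_)
  simp

theorem restrictDegree_mono {d : ℕ} : Monotone (MvPolynomial.restrictDegree (Fin d) k) :=
  fun m m' h b hb => by
    rw [MvPolynomial.mem_restrictDegree] at hb ⊢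
    exact fun s hs i => (hb s hs i).trans h

theorem mul_mem_restrictDegree {d m m' : ℕ} {b b' : MvPolynomial (Fin d) k}
    (hb : b ∈ MvPolynomial.restrictDegree (Fin d) k m)
    (hb' : b' ∈ MvPolynomial.restrictDegree (Fin d) k m') :
    b * b' ∈ MvPolynomial.restrictDegree (Fin d) k (m + m') := by
  classical
  rw [MvPolynomial.mem_restrictDegree] at hb hb' ⊢
  intro s hs i
  obtain ⟨t, ht, t', ht', rfl⟩ := Finset.mem_add.1 (MvPolynomial.support_mul b b' hs)
  exact Nat.add_le_add (hb t ht i) (hb' t' ht' i)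

theorem mem_restrictDegree_totalDegree {d : ℕ} (b : MvPolynomial (Fin d) k) :
    b ∈ MvPolynomial.restrictDegree (Fin d) k b.totalDegree :=
  MvPolynomial.restrictTotalDegree_le_restrictDegree (R := k) (σ := Fin d) _
    ((MvPolynomial.mem_restrictTotalDegree _ _ _).2 le_rfl)

/-- Compare with `W m`, the combinations of the e_j whose coefficients have degree at most m in each
variable. Multiplication by any X_i costs at most a constant E in m, and beyond m1 the filtration
grows only through the X_i, so `Fil m` lies in `W (m0 + E * m)`. -/
theorem finrank_filtration_le (hmono : Monotone Fil)
    (hfin : ∀ m, FiniteDimensional k (Fil m)) {m1 : ℕ}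
    (hgen : ∀ m ≥ m1, ∀ W : Submodule k C, Fil m ≤ W →
      (∀ i, ∀ c ∈ Fil m, (MvPolynomial.X i : MvPolynomial (Fin n) k) • c ∈ W) → Fil (m + 1) ≤ W)
    {d : ℕ} (φ : MvPolynomial (Fin d) k →ₐ[k] MvPolynomial (Fin n) k) {r : ℕ} {e : Fin r → C}
    (he : ∀ c, ∃ b : Fin r → MvPolynomial (Fin d) k, c = ∑ j, φ (b j) • e j) :
    ∃ K : ℕ, ∀ m : ℕ, Module.finrank k (Fil m) ≤ K * (m + 1) ^ d := by
  let W : ℕ → Submodule k C := fun m => LinearMap.range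
    (∑ j, (((LinearMap.toSpanSingleton (MvPolynomial (Fin n) k) C (e j)).restrictScalars k ∘ₗ
      φ.toLinearMap) ∘ₗ (MvPolynomial.restrictDegree (Fin d) k m).subtype) ∘ₗ
        LinearMap.proj (φ := fun _ : Fin r => MvPolynomial.restrictDegree (Fin d) k m) j)
  have hWmem : ∀ m c, c ∈ W m ↔ ∃ b : Fin r → MvPolynomial (Fin d) k,
      (∀ j, b j ∈ MvPolynomial.restrictDegree (Fin d) k m) ∧ c = ∑ j, φ (b j) • e j := by
    intro m c
    constructor
    · rintro ⟨b, rfl⟩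
      exact ⟨fun j => b j, fun j => (b j).2, by simp⟩
    · rintro ⟨b, hb, rfl⟩
      exact ⟨fun j => ⟨b j, hb j⟩, by simp⟩
  have hWmono : Monotone W := fun m m' h c hc => by
    rw [hWmem] at hc ⊢
    obtain ⟨b, hb, rfl⟩ := hc
    exact ⟨b, fun j => restrictDegree_mono h (hb j), rfl⟩
  have hWtop : ∀ c, ∃ m, c ∈ W m := fun c => by
    obtain ⟨b, hb⟩ := he c
    refine ⟨∑ j, (b j).totalDegree, (hWmem _ _).2 ⟨b, fun j => ?_, hb⟩⟩
    exact restrictDegree_mono (Finset.single_le_sum (f := fun j => (b j).totalDegree)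
      (fun _ _ => Nat.zero_le _) (Finset.mem_univ j)) (mem_restrictDegree_totalDegree _)
  have hWrank : ∀ m, Module.finrank k (W m) ≤ r * (m + 1) ^ d := fun m => by
    refine (LinearMap.finrank_range_le _).trans ?_
    rw [Module.finrank_pi_fintype, Finset.sum_const, Finset.card_univ, Fintype.card_fin,
      smul_eq_mul]
    exact Nat.mul_le_mul le_rfl (finrank_restrictDegree_le d m)
  choose a ha using fun (i : Fin n) (j : Fin r) =>
    he ((MvPolynomial.X i : MvPolynomial (Fin n) k) • e j)
  set E := ∑ i, ∑ j, ∑ l, (a i j l).totalDegree with hE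
  have haE : ∀ i j l, a i j l ∈ MvPolynomial.restrictDegree (Fin d) k E := fun i j l => by
    refine restrictDegree_mono ?_ (mem_restrictDegree_totalDegree _)
    calc _ ≤ ∑ l, (a i j l).totalDegree := Finset.single_le_sum
          (f := fun l => (a i j l).totalDegree) (fun _ _ => Nat.zero_le _) (Finset.mem_univ l)
      _ ≤ ∑ j, ∑ l, (a i j l).totalDegree := Finset.single_le_sum
          (f := fun j => ∑ l, (a i j l).totalDegree) (fun _ _ => Nat.zero_le _) (Finset.mem_univ j)
      _ ≤ E := Finset.single_le_sum (f := fun i => ∑ j, ∑ l, (a i j l).totalDegree)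
          (fun _ _ => Nat.zero_le _) (Finset.mem_univ i)
  have hWx : ∀ i m c, c ∈ W m → (MvPolynomial.X i : MvPolynomial (Fin n) k) • c ∈ W (m + E) := by
    intro i m c hc
    obtain ⟨b, hb, rfl⟩ := (hWmem _ _).1 hc
    rw [Finset.smul_sum]
    refine Submodule.sum_mem _ fun j _ => ?_
    rw [smul_comm, ha, Finset.smul_sum, hWmem]
    refine ⟨fun l => b j * a i j l, fun l => mul_mem_restrictDegree (hb j) (haE i j l), ?_⟩
    exact Finset.sum_congr rfl fun l _ => by rw [map_mul, mul_smul]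
  obtain ⟨m0, hm0⟩ : ∃ m0, Fil m1 ≤ W m0 := by
    obtain ⟨s, hs⟩ := (Submodule.fg_iff_finiteDimensional (Fil m1)).2 (hfin m1)
    choose g hg using hWtop
    refine ⟨s.sup g, ?_⟩
    rw [← hs, Submodule.span_le]
    exact fun c hc => hWmono (Finset.le_sup hc) (hg c)
  have hFil : ∀ m, Fil m ≤ W (m0 + E * m) := by
    intro m
    induction m with
    | zero => exact (hmono (Nat.zero_le m1)).trans (hm0.trans (hWmono (by lia)))
    | succ m ih =>
      rcases lt_or_ge m m1 with h | h
      · exact (hmono h).trans (hm0.trans (hWmono (by lia)))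
      · refine hgen m h _ (ih.trans (hWmono (by rw [mul_add]; lia))) fun i c hc => ?_
        have := hWx i _ _ (ih hc)
        rwa [mul_add, mul_one, ← add_assoc]
  -- The constant comes from m0 + Em + 1 ≤ (m0 + E + 1)(m + 1).
  refine ⟨r * (m0 + E + 1) ^ d, fun m => ?_⟩
  refine (Submodule.finrank_mono (hFil m)).trans ((hWrank _).trans ?_)
  rw [mul_assoc, ← mul_pow]
  refine Nat.mul_le_mul le_rfl (Nat.pow_le_pow_left ?_ d)
  nlinarith [Nat.zero_le (m0 * m)]

end Growth

/-! ## Graded vector spaces -/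

section Graded

variable {k : Type*} [Field k] {M : Type*} [AddCommGroup M] [Module k M]
  {𝒢 : ℤ → Submodule k M}

/-- A graded vector space as the external direct sum of its components. -/
def gradedEquiv (h𝒢 : DirectSum.IsInternal 𝒢) : (DirectSum ℤ fun i => 𝒢 i) ≃ₗ[k] M :=
  have h : Function.Bijective (DirectSum.coeLinearMap 𝒢) := h𝒢
  LinearEquiv.ofBijective (DirectSum.coeLinearMap 𝒢) h

theorem gradedEquiv_lof (h𝒢 : DirectSum.IsInternal 𝒢) (i : ℤ) (m : 𝒢 i) :
    gradedEquiv h𝒢 (DirectSum.lof k ℤ (fun i => 𝒢 i) i m) = m :=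
  DirectSum.coeLinearMap_lof _ _ _

/-- The projection of a graded vector space onto its component of degree `i`. -/
def gradedProj (h𝒢 : DirectSum.IsInternal 𝒢) (i : ℤ) : M →ₗ[k] M :=
  (𝒢 i).subtype ∘ₗ DirectSum.component k ℤ (fun i => 𝒢 i) i ∘ₗ (gradedEquiv h𝒢).symm.toLinearMap

theorem gradedProj_mem (h𝒢 : DirectSum.IsInternal 𝒢) (i : ℤ) (m : M) : gradedProj h𝒢 i m ∈ 𝒢 i := by
  simp [gradedProj]

theorem gradedProj_of_mem (h𝒢 : DirectSum.IsInternal 𝒢) {i : ℤ} {m : M} (hm : m ∈ 𝒢 i) (j : ℤ) :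
    gradedProj h𝒢 j m = if i = j then m else 0 := by
  have h : (gradedEquiv h𝒢).symm m = DirectSum.lof k ℤ (fun i => 𝒢 i) i ⟨m, hm⟩ := by
    rw [LinearEquiv.symm_apply_eq, gradedEquiv_lof]
  simp only [gradedProj, LinearMap.comp_apply, LinearEquiv.coe_coe, h]
  split_ifs with hij
  · subst hij
    rw [DirectSum.component.lof_self]
    rfl
  · rw [DirectSum.component.of]
    simp [hij]

theorem gradedProj_same (h𝒢 : DirectSum.IsInternal 𝒢) {i : ℤ} {m : M} (hm : m ∈ 𝒢 i) : gradedProj h𝒢 i m = m := by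
  rw [gradedProj_of_mem h𝒢 hm, if_pos rfl]

theorem exists_sum_gradedProj (h𝒢 : DirectSum.IsInternal 𝒢) (m : M) :
    ∃ S : Finset ℤ, (∀ i ∉ S, gradedProj h𝒢 i m = 0) ∧ m = ∑ i ∈ S, gradedProj h𝒢 i m := by
  classical
  have htop : m ∈ ⨆ i, 𝒢 i := h𝒢.submodule_iSup_eq_top ▸ Submodule.mem_top
  induction htop using Submodule.iSup_induction' with
  | mem i x hx =>
    refine ⟨{i}, fun j hj => ?_, ?_⟩
    · rw [gradedProj_of_mem h𝒢 hx, if_neg (by simpa [eq_comm] using hj)]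
    · rw [Finset.sum_singleton, gradedProj_same h𝒢 hx]
  | zero => exact ⟨∅, by simp, by simp⟩
  | add x y _ _ hx hy =>
    obtain ⟨S, hS, hS'⟩ := hx
    obtain ⟨S', hT, hT'⟩ := hy
    refine ⟨S ∪ S', fun i hi => ?_, ?_⟩
    · rw [Finset.notMem_union] at hi
      rw [map_add, hS i hi.1, hT i hi.2, add_zero]
    · simp only [map_add, Finset.sum_add_distrib]
      rw [← Finset.sum_subset Finset.subset_union_left fun i _ hi => hS i hi,
        ← Finset.sum_subset Finset.subset_union_right fun i _ hi => hT i hi, ← hS', ← hT']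

theorem gradedProj_map (h𝒢 : DirectSum.IsInternal 𝒢)
    {M' : Type*} [AddCommGroup M'] [Module k M'] {𝒢' : ℤ → Submodule k M'}
    (h𝒢' : DirectSum.IsInternal 𝒢') {T : M →ₗ[k] M'} {a : ℤ}
    (hT : ∀ j, ∀ m ∈ 𝒢 j, T m ∈ 𝒢' (j + a)) (i : ℤ) (m : M) :
    gradedProj h𝒢' (i + a) (T m) = T (gradedProj h𝒢 i m) := by
  have htop : m ∈ ⨆ i, 𝒢 i := h𝒢.submodule_iSup_eq_top ▸ Submodule.mem_top
  induction htop using Submodule.iSup_induction' with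
  | mem j x hx =>
    rw [gradedProj_of_mem h𝒢 hx, gradedProj_of_mem h𝒢' (hT j x hx)]
    by_cases h : j = i <;> simp [h]
  | zero => simp
  | add x y _ _ hx hy => rw [map_add, map_add, hx, hy, map_add, map_add]

theorem le_of_iSup_eq_top (h𝒢 : DirectSum.IsInternal 𝒢)
    {W : ℤ → Submodule k M} (hW : ∀ i, W i ≤ 𝒢 i) (htop : ⨆ i, W i = ⊤)
    (i : ℤ) : 𝒢 i ≤ W i := by
  intro m hm
  have key : ∀ y : M, gradedProj h𝒢 i y ∈ W i := fun y => by
    have hy : y ∈ ⨆ i, W i := htop ▸ Submodule.mem_top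
    induction hy using Submodule.iSup_induction' with
    | mem j x hx =>
      rw [gradedProj_of_mem h𝒢 (hW j hx)]
      split_ifs with h
      · exact h ▸ hx
      · exact zero_mem _
    | zero => simp
    | add x y _ _ hx hy => rw [map_add]; exact add_mem hx hy
  exact gradedProj_same h𝒢 hm ▸ key m

/-- A graded vector space finitely generated under finitely many operators of degree one. -/
theorem bddBelow_and_finite_of_generated (h𝒢 : DirectSum.IsInternal 𝒢)
    {ι : Type*} [Finite ι] {T : ι → M →ₗ[k] M}
    (hT : ∀ s j, ∀ m ∈ 𝒢 j, T s m ∈ 𝒢 (j + 1)) (F : Finset M)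
    (hF : ∀ W : Submodule k M, (F : Set M) ⊆ W → (∀ s, ∀ m ∈ W, T s m ∈ W) → W = ⊤) :
    (∃ k0 : ℤ, ∀ j < k0, 𝒢 j = ⊥) ∧ (∀ j, FiniteDimensional k (𝒢 j)) ∧
      ∃ i1 : ℤ, ∀ j ≥ i1, 𝒢 (j + 1) ≤ ⨆ s, (𝒢 j).map (T s) := by
  classical
  choose S hS hsum using exists_sum_gradedProj h𝒢
  set S' := F.biUnion S with hS'
  obtain ⟨k0, hk0⟩ := S'.bddBelow
  obtain ⟨i1, hi1⟩ := S'.bddAbove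
  let V : ℤ → Submodule k M := fun j => Submodule.span k (gradedProj h𝒢 j '' F)
  have hV : ∀ j, V j ≤ 𝒢 j := fun j => Submodule.span_le.2 (by
    rintro _ ⟨m, -, rfl⟩
    exact gradedProj_mem h𝒢 j m)
  have hVbot : ∀ j, j ∉ S' → V j = ⊥ := fun j hj => by
    rw [Submodule.span_eq_bot]
    rintro _ ⟨m, hm, rfl⟩
    exact hS m j fun h => hj (Finset.mem_biUnion.2 ⟨m, hm, h⟩)
  have hVfin : ∀ j, FiniteDimensional k (V j) := fun j =>
    FiniteDimensional.span_of_finite k (F.finite_toSet.image _)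
  -- Candidates for the components from degree k0 on: the generators' parts in that degree plus the
  -- images of the previous candidate. Their sum contains F and is stable under all T s, so they
  -- exhaust the grading.
  obtain ⟨W, hW0, hWs⟩ : ∃ W : ℕ → Submodule k M, W 0 = V k0 ∧
      ∀ m, W (m + 1) = V (k0 + (m + 1 : ℕ)) ⊔ ⨆ s, (W m).map (T s) :=
    ⟨fun m => Nat.rec (V k0) (fun m P => V (k0 + (m + 1 : ℕ)) ⊔ ⨆ s, P.map (T s)) m,
      rfl, fun _ => rfl⟩
  have hWV : ∀ m : ℕ, V (k0 + m) ≤ W m := fun m => by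
    cases m with
    | zero => simp [hW0]
    | succ m => rw [hWs]; exact le_sup_left
  have hWfin : ∀ m, FiniteDimensional k (W m) := fun m => by
    induction m with
    | zero => rw [hW0]; infer_instance
    | succ m ih => rw [hWs]; infer_instance
  have hWle : ∀ m : ℕ, W m ≤ 𝒢 (k0 + m) := fun m => by
    induction m with
    | zero => simpa [hW0] using hV k0
    | succ m ih =>
      rw [hWs]
      refine sup_le (hV _) (iSup_le fun s => Submodule.map_le_iff_le_comap.2 fun x hx => ?_)
      have := hT s _ x (ih hx)
      rwa [add_assoc] at this
  let W' : ℤ → Submodule k M := fun j => if k0 ≤ j then W (j - k0).toNat else ⊥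
  have hW'W : ∀ m : ℕ, W' (k0 + m) = W m := fun m => by simp [W']
  have hW' : ∀ j, W' j ≤ 𝒢 j := fun j => by
    by_cases h : k0 ≤ j
    · obtain ⟨m, rfl⟩ := Int.le.dest h
      rw [hW'W]
      exact hWle m
    · simp [W', h]
  have htop : ⨆ j, W' j = ⊤ := by
    refine hF _ (fun m hm => ?_) fun s m hm => ?_
    · rw [hsum m]
      refine Submodule.sum_mem _ fun j hj => ?_
      have hjS : j ∈ S' := Finset.mem_biUnion.2 ⟨m, hm, hj⟩
      obtain ⟨l, rfl⟩ := Int.le.dest (hk0 hjS)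
      refine Submodule.mem_iSup_of_mem (k0 + l) ?_
      rw [hW'W]
      exact hWV l (Submodule.subset_span ⟨m, hm, rfl⟩)
    · suffices h : ⨆ j, W' j ≤ (⨆ j, W' j).comap (T s) from h hm
      refine iSup_le fun j => ?_
      by_cases h : k0 ≤ j
      · obtain ⟨l, rfl⟩ := Int.le.dest h
        intro x hx
        rw [hW'W] at hx
        refine Submodule.mem_iSup_of_mem (k0 + (l + 1 : ℕ)) ?_
        rw [hW'W, hWs]
        exact Submodule.mem_sup_right (Submodule.mem_iSup_of_mem s ⟨x, hx, rfl⟩)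
      · simp [W', h]
  have heq : ∀ j, 𝒢 j = W' j := fun j => le_antisymm (le_of_iSup_eq_top h𝒢 hW' htop j) (hW' j)
  refine ⟨⟨k0, fun j hj => ?_⟩, fun j => ?_, max i1 k0, fun j hj => ?_⟩
  · rw [heq]
    simp [W', hj]
  · rw [heq]
    by_cases h : k0 ≤ j
    · have h1 : W' j = W (j - k0).toNat := if_pos h
      rw [h1]
      infer_instance
    · have h1 : W' j = ⊥ := if_neg h
      rw [h1]
      infer_instance
  · obtain ⟨l, rfl⟩ := Int.le.dest ((le_max_right _ _).trans hj)
    have h1 : k0 + (l : ℤ) + 1 = k0 + (l + 1 : ℕ) := by push_cast; ring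
    rw [h1, heq, heq, hW'W, hW'W, hWs, hVbot, bot_sup_eq]
    intro hmem
    have := hi1 hmem
    have h2 := (le_max_left i1 k0).trans hj
    push_cast at this
    lia

/-- Quotients of graded vector spaces by graded subspaces are graded. -/
theorem isInternal_map_of_surjective (h𝒢 : DirectSum.IsInternal 𝒢)
    {M' : Type*} [AddCommGroup M'] [Module k M']
    {π : M →ₗ[k] M'} (hπ : Function.Surjective π)
    (hker : ∀ m, π m = 0 → ∀ i, π (gradedProj h𝒢 i m) = 0) :
    DirectSum.IsInternal fun i => (𝒢 i).map π := by
  classical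
  rw [DirectSum.isInternal_submodule_iff_iSupIndep_and_iSup_eq_top]
  constructor
  · refine fun i => Submodule.disjoint_def.2 ?_
    rintro _ ⟨g, hg, rfl⟩ hy
    simp only [← Submodule.map_iSup] at hy
    obtain ⟨y, hy, hyg⟩ := hy
    have hle : ⨆ (j) (_ : j ≠ i), 𝒢 j ≤ LinearMap.ker (gradedProj h𝒢 i) :=
      iSup₂_le fun j hj x hx => by
        rw [LinearMap.mem_ker, gradedProj_of_mem h𝒢 hx, if_neg hj]
    have h0 : gradedProj h𝒢 i y = 0 := hle hy
    -- The degree-i part of g - y is g, because y only has parts in other degrees.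
    have := hker (g - y) (by rw [map_sub, hyg, sub_self]) i
    rwa [map_sub, h0, sub_zero, gradedProj_same h𝒢 hg] at this
  · rw [← Submodule.map_iSup, h𝒢.submodule_iSup_eq_top, Submodule.map_top, LinearMap.range_eq_top]
    exact hπ

end Graded

/-! ## Hilbert series of graded modules over polynomial rings -/

section HilbertSeries

variable {k : Type*} [Field k] {n : ℕ} {C : Type*} [AddCommGroup C] [Module k C]
  [Module (MvPolynomial (Fin n) k) C] [IsScalarTower k (MvPolynomial (Fin n) k) C]
  {𝒢 : ℤ → Submodule k C}

/-- Multiplication by the variable `X i`. -/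
def mulX (k : Type*) [Field k] {n : ℕ} (C : Type*) [AddCommGroup C] [Module k C]
    [Module (MvPolynomial (Fin n) k) C] [IsScalarTower k (MvPolynomial (Fin n) k) C] (i : Fin n) :
    C →ₗ[k] C :=
  (LinearMap.lsmul (MvPolynomial (Fin n) k) C (MvPolynomial.X i)).restrictScalars k

theorem mulX_apply (i : Fin n) (c : C) :
    mulX k C i c = (MvPolynomial.X i : MvPolynomial (Fin n) k) • c := rfl

theorem smul_mem_of_mulX_mem {W : Submodule k C} (hW : ∀ i : Fin n, ∀ c ∈ W, mulX k C i c ∈ W)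
    (a : MvPolynomial (Fin n) k) {c : C} (hc : c ∈ W) : a • c ∈ W := by
  induction a using MvPolynomial.induction_on generalizing c with
  | C r =>
    rw [← MvPolynomial.algebraMap_eq, algebraMap_smul]
    exact W.smul_mem r hc
  | add a b ha hb => rw [add_smul]; exact add_mem (ha hc) (hb hc)
  | mul_X a i ha => rw [mul_smul]; exact ha (hW i c hc)

/-- The component of degree `i` of a submodule. -/
def homPart (𝒢 : ℤ → Submodule k C) (K : Submodule (MvPolynomial (Fin n) k) C) (i : ℤ) :
    Submodule k C :=
  K.restrictScalars k ⊓ 𝒢 i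

theorem mem_homPart {K : Submodule (MvPolynomial (Fin n) k) C} {i : ℤ} {c : C} :
    c ∈ homPart 𝒢 K i ↔ c ∈ K ∧ c ∈ 𝒢 i := Iff.rfl

/-- The dimension of the component of degree `i` of a submodule. -/
def homRank (𝒢 : ℤ → Submodule k C) (K : Submodule (MvPolynomial (Fin n) k) C) (i : ℤ) : ℕ :=
  Module.finrank k (homPart 𝒢 K i)

/-- The multiplication by a variable on a subquotient `L / K`: dimension count for its
kernel `L' / K` and its cokernel `L / K'`. -/
theorem finrank_homPart_add (h𝒢 : DirectSum.IsInternal 𝒢)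
    (hX : ∀ (i : Fin n) j, ∀ c ∈ 𝒢 j, mulX k C i c ∈ 𝒢 (j + 1)) (hfin : ∀ j, FiniteDimensional k (𝒢 j))
    {K L : Submodule (MvPolynomial (Fin n) k) C} (hK : ∀ c ∈ K, ∀ i, gradedProj h𝒢 i c ∈ K)
    (hL : ∀ c ∈ L, ∀ i, gradedProj h𝒢 i c ∈ L) (j : Fin n) (i : ℤ) :
    homRank 𝒢 L i + homRank 𝒢 K (i + 1) =
      homRank 𝒢 (L ⊓ K.comap (LinearMap.lsmul _ C (MvPolynomial.X j))) i +
      homRank 𝒢 (K ⊔ L.map (LinearMap.lsmul _ C (MvPolynomial.X j))) (i + 1) := by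
  have hfin' : ∀ (P : Submodule (MvPolynomial (Fin n) k) C) i,
      FiniteDimensional k (homPart 𝒢 P i) := fun P i =>
    Submodule.finiteDimensional_of_le (inf_le_right : homPart 𝒢 P i ≤ 𝒢 i)
  have := hfin' L i
  have := hfin' K (i + 1)
  set K' := K ⊔ L.map (LinearMap.lsmul _ C (MvPolynomial.X j)) with hK'
  set L' := L ⊓ K.comap (LinearMap.lsmul _ C (MvPolynomial.X j)) with hL'
  -- Rank-nullity for (l, c) ↦ X_j l + c: the image is the degree i + 1 part of `K'`, and the kernel
  -- is a copy of the degree i part of `L'` via l ↦ (l, -X_j l).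
  let ψ : (homPart 𝒢 L i) × (homPart 𝒢 K (i + 1)) →ₗ[k] C :=
    (mulX k C j ∘ₗ (homPart 𝒢 L i).subtype).coprod (homPart 𝒢 K (i + 1)).subtype
  have hrange : LinearMap.range ψ = homPart 𝒢 K' (i + 1) := by
    apply le_antisymm
    · rintro _ ⟨⟨⟨l, hl⟩, ⟨c, hc⟩⟩, rfl⟩
      rw [mem_homPart] at hl hc
      refine ⟨?_, add_mem (hX j i l hl.2) hc.2⟩
      exact add_mem (Submodule.mem_sup_right ⟨l, hl.1, rfl⟩) (Submodule.mem_sup_left hc.1)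
    · intro c hc
      obtain ⟨hc1, hc2⟩ := mem_homPart.1 hc
      obtain ⟨κ, hκ, _, ⟨l, hl, rfl⟩, rfl⟩ := Submodule.mem_sup.1 hc1
      refine ⟨(⟨gradedProj h𝒢 i l, hL l hl i, gradedProj_mem h𝒢 i l⟩,
        ⟨gradedProj h𝒢 (i + 1) κ, hK κ hκ _, gradedProj_mem h𝒢 _ κ⟩), ?_⟩
      have h1 := gradedProj_same h𝒢 hc2
      rw [map_add] at h1
      have h2 := gradedProj_map h𝒢 h𝒢 (hX j) i l
      refine Eq.trans ?_ h1
      change mulX k C j (gradedProj h𝒢 i l) + gradedProj h𝒢 (i + 1) κ = _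
      rw [← h2, add_comm]
      rfl
  let χ : homPart 𝒢 L' i →ₗ[k] (homPart 𝒢 L i) × (homPart 𝒢 K (i + 1)) :=
    LinearMap.prod (Submodule.inclusion (inf_le_inf_right _ fun c hc => hc.1))
      (LinearMap.codRestrict _ (-(mulX k C j ∘ₗ (homPart 𝒢 L' i).subtype)) fun c =>
        ⟨neg_mem c.2.1.2, neg_mem (hX j i c c.2.2)⟩)
  have hχ : Function.Injective χ := fun c c' h => by
    have := congrArg (fun q => ((q.1 : homPart 𝒢 L i) : C)) h
    exact Subtype.ext this
  have hker : LinearMap.range χ = LinearMap.ker ψ := by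
    apply le_antisymm
    · rintro _ ⟨c, rfl⟩
      change mulX k C j c + -(mulX k C j c) = 0
      exact add_neg_cancel _
    · rintro ⟨⟨l, hl⟩, ⟨c, hc⟩⟩ h
      have h : mulX k C j l + c = 0 := h
      rw [mem_homPart] at hl hc
      have hc' : -(mulX k C j l) = c := (eq_neg_of_add_eq_zero_right h).symm
      refine ⟨⟨l, ⟨hl.1, ?_⟩, hl.2⟩, ?_⟩
      · change mulX k C j l ∈ K
        rw [← neg_mem_iff, hc']
        exact hc.1
      · exact Prod.ext rfl (Subtype.ext hc')
  have h1 := LinearMap.finrank_range_add_finrank_ker ψ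
  rw [hrange, ← hker, LinearMap.finrank_range_of_inj hχ, Module.finrank_prod] at h1
  simp only [homRank]
  lia

theorem exists_polynomial_of_eventually_zero {h : ℕ → ℤ} {M : ℕ} (hM : ∀ m ≥ M, h m = 0) :
    ∃ q : ℤ[X], PowerSeries.mk h = (q : ℤ⟦X⟧) := by
  refine ⟨PowerSeries.trunc M (PowerSeries.mk h), ?_⟩
  ext m
  rw [Polynomial.coeff_coe, PowerSeries.coeff_trunc]
  split_ifs with hm
  · rfl
  · rw [PowerSeries.coeff_mk, hM m (not_lt.1 hm)]

/-- Hilbert-Serre induction on the set s of variables that may act nontrivially on L / K; pairs K ≤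
L inside a fixed C stand for all subquotients. Kernel L' / K and cokernel L / K' of X_j are killed
by X_j, and the dimension count reads (1-X) h_{L/K} = h_{L/K'} - X h_{L'/K}. -/
theorem exists_hilbert_serre_numerator (h𝒢 : DirectSum.IsInternal 𝒢)
    (hX : ∀ (i : Fin n) j, ∀ c ∈ 𝒢 j, mulX k C i c ∈ 𝒢 (j + 1)) (hfin : ∀ j, FiniteDimensional k (𝒢 j))
    [IsNoetherian (MvPolynomial (Fin n) k) C] {k0 : ℤ} (hk0 : ∀ j < k0, 𝒢 j = ⊥)
    (s : Finset (Fin n)) (K L : Submodule (MvPolynomial (Fin n) k) C) (hKL : K ≤ L)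
    (hK : ∀ c ∈ K, ∀ i, gradedProj h𝒢 i c ∈ K) (hL : ∀ c ∈ L, ∀ i, gradedProj h𝒢 i c ∈ L)
    (hs : ∀ i ∉ s, ∀ c ∈ L, mulX k C i c ∈ K) :
    ∃ q : ℤ[X], (1 - PowerSeries.X) ^ s.card * PowerSeries.mk (fun m : ℕ =>
      (homRank 𝒢 L (k0 + m) : ℤ) -
        homRank 𝒢 K (k0 + m)) = (q : ℤ⟦X⟧) := by
  classical
  induction s using Finset.induction_on generalizing K L with
  | empty =>
    simp only [Finset.card_empty, pow_zero, one_mul]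
    obtain ⟨F, hF⟩ := IsNoetherian.noetherian L
    choose S hS _ using exists_sum_gradedProj h𝒢
    obtain ⟨I, hI⟩ := (F.biUnion S).bddAbove
    -- All variables send L into K, so modulo K only scalar multiples of the generators survive, and
    -- these have no part above degree I.
    have key : ∀ i, I < i → homPart 𝒢 L i ≤ homPart 𝒢 K i := by
      intro i hi
      have hle : L.restrictScalars k ≤
          K.restrictScalars k ⊔ LinearMap.ker (gradedProj h𝒢 i) := by
        have hLW : ∀ c ∈ L, c ∈ K.restrictScalars k ⊔
            LinearMap.ker (gradedProj h𝒢 i) ⊓ L.restrictScalars k := by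
          intro c hc
          rw [← hF] at hc
          induction hc using Submodule.span_induction with
          | mem c hc =>
            refine Submodule.mem_sup_right ⟨hS c i fun hmem => ?_, hF ▸ Submodule.subset_span hc⟩
            exact absurd (hI (Finset.mem_coe.2 (Finset.mem_biUnion.2 ⟨c, hc, hmem⟩))) (not_le.2 hi)
          | zero => exact zero_mem _
          | add x y _ _ hx hy => exact add_mem hx hy
          | smul a x _ hx =>
            refine smul_mem_of_mulX_mem (fun j c hc => Submodule.mem_sup_left ?_) a hx
            refine hs j (Finset.notMem_empty j) c ?_
            have : K.restrictScalars k ⊔ LinearMap.ker (gradedProj h𝒢 i) ⊓ L.restrictScalars k ≤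
              L.restrictScalars k := sup_le hKL inf_le_right
            exact this hc
        have hle : K.restrictScalars k ⊔ LinearMap.ker (gradedProj h𝒢 i) ⊓ L.restrictScalars k ≤
            K.restrictScalars k ⊔ LinearMap.ker (gradedProj h𝒢 i) :=
          sup_le_sup le_rfl inf_le_left
        exact fun c hc => hle (hLW c hc)
      intro c hc
      refine ⟨?_, hc.2⟩
      obtain ⟨κ, hκ, y, hy, rfl⟩ := Submodule.mem_sup.1 (hle hc.1)
      have := gradedProj_same h𝒢 hc.2
      rw [map_add, LinearMap.mem_ker.1 hy, add_zero] at this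
      rw [← this]
      exact hK κ hκ i
    refine exists_polynomial_of_eventually_zero (M := (I + 1 - k0).toNat) fun m hm => ?_
    have hm' : I < k0 + m := by lia
    rw [homRank, homRank, le_antisymm (key _ hm') (inf_le_inf_right _ hKL), sub_self]
  | insert j s hj ih =>
    set K' := K ⊔ L.map (LinearMap.lsmul _ C (MvPolynomial.X j)) with hK'
    set L' := L ⊓ K.comap (LinearMap.lsmul _ C (MvPolynomial.X j)) with hL'
    have hmap : L.map (LinearMap.lsmul _ C (MvPolynomial.X j)) ≤ L := by
      rintro _ ⟨l, hl, rfl⟩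
      exact L.smul_mem _ hl
    have hproj : ∀ i c, gradedProj h𝒢 i (mulX k C j c) = mulX k C j (gradedProj h𝒢 (i - 1) c) :=
      fun i c => by
        have := gradedProj_map h𝒢 h𝒢 (hX j) (i - 1) c
        rwa [sub_add_cancel] at this
    obtain ⟨q1, hq1⟩ := ih K' L (sup_le hKL hmap) (fun c hc i => by
        obtain ⟨κ, hκ, _, ⟨l, hl, rfl⟩, rfl⟩ := Submodule.mem_sup.1 hc
        rw [map_add]
        refine add_mem (Submodule.mem_sup_left (hK κ hκ i)) (Submodule.mem_sup_right ?_)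
        exact ⟨_, hL l hl (i - 1), (hproj i l).symm⟩) hL (fun i hi c hc => by
        rcases eq_or_ne i j with rfl | hij
        · exact Submodule.mem_sup_right ⟨c, hc, rfl⟩
        · exact Submodule.mem_sup_left (hs i (by simp [hi, hij]) c hc))
    obtain ⟨q2, hq2⟩ := ih K L' (le_inf hKL fun c hc => K.smul_mem _ hc) hK (fun c hc i => by
        refine ⟨hL c hc.1 i, ?_⟩
        change mulX k C j _ ∈ K
        have := hproj (i + 1) c
        rw [add_sub_cancel_right] at this
        rw [← this]
        exact hK _ hc.2 _) (fun i hi c hc => by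
        rcases eq_or_ne i j with rfl | hij
        · exact hc.2
        · exact hs i (by simp [hi, hij]) c hc.1)
    refine ⟨q1 - Polynomial.X * q2, ?_⟩
    have hid : ∀ i, homRank 𝒢 L i + homRank 𝒢 K (i + 1) =
        homRank 𝒢 L' i + homRank 𝒢 K' (i + 1) :=
      fun i => finrank_homPart_add h𝒢 hX hfin hK hL j i
    rw [Finset.card_insert_of_notMem hj, pow_succ, mul_assoc]
    push_cast
    rw [← hq1, ← hq2, mul_left_comm PowerSeries.X, ← mul_sub]
    congr 1
    ext m
    cases m with
    | zero =>
      -- In degree k0 - 1 everything vanishes, so K and `K'` have the same dimension in degree k0.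
      have h0 := hid (k0 - 1)
      have hz : ∀ P : Submodule (MvPolynomial (Fin n) k) C,
          homRank 𝒢 P (k0 - 1) = 0 := fun P => by
        rw [homRank, homPart, hk0 _ (by lia), inf_bot_eq, finrank_bot]
      rw [hz, hz, sub_add_cancel] at h0
      simp only [sub_mul, one_mul, map_sub, PowerSeries.coeff_zero_X_mul, PowerSeries.coeff_mk]
      simp only [Nat.cast_zero, add_zero, sub_zero]
      lia
    | succ m =>
      have h0 := hid (k0 + m)
      simp only [sub_mul, one_mul, map_sub, PowerSeries.coeff_succ_X_mul, PowerSeries.coeff_mk]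
      push_cast
      rw [← add_assoc]
      lia

end HilbertSeries

/-! ### Exact order of the pole at 1 for graded modules over polynomial rings -/

section Dimension

variable {k : Type*} [Field k] {C : Type*} [AddCommGroup C] [Module k C] {𝒢 : ℤ → Submodule k C}

/-- The sum of the components of degrees `k0, …, k0 + m` of a graded vector space. -/
def degreeFiltration (𝒢 : ℤ → Submodule k C) (k0 : ℤ) (m : ℕ) : Submodule k C :=
  (Finset.range (m + 1)).sup fun j : ℕ => 𝒢 (k0 + j)

theorem degreeFiltration_zero (k0 : ℤ) : degreeFiltration 𝒢 k0 0 = 𝒢 (k0 + (0 : ℕ)) := by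
  rw [degreeFiltration, zero_add, Finset.range_one, Finset.sup_singleton]

theorem degreeFiltration_succ (k0 : ℤ) (m : ℕ) :
    degreeFiltration 𝒢 k0 (m + 1) = degreeFiltration 𝒢 k0 m ⊔ 𝒢 (k0 + (m + 1 : ℕ)) := by
  rw [degreeFiltration, Finset.range_add_one, Finset.sup_insert, sup_comm]
  rfl

theorem degreeFiltration_mono (k0 : ℤ) : Monotone (degreeFiltration 𝒢 k0) :=
  monotone_nat_of_le_succ fun m => by rw [degreeFiltration_succ]; exact le_sup_left

theorem le_degreeFiltration {k0 : ℤ} {j m : ℕ} (h : j ≤ m) :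
    𝒢 (k0 + j) ≤ degreeFiltration 𝒢 k0 m :=
  Finset.le_sup (f := fun j : ℕ => 𝒢 (k0 + j)) (Finset.mem_range_succ_iff.2 h)

theorem gradedProj_degreeFiltration (h𝒢 : DirectSum.IsInternal 𝒢) {k0 : ℤ} {m : ℕ} {i : ℤ}
    (hi : k0 + m < i) {c : C} (hc : c ∈ degreeFiltration 𝒢 k0 m) : gradedProj h𝒢 i c = 0 := by
  have hle : degreeFiltration 𝒢 k0 m ≤ LinearMap.ker (gradedProj h𝒢 i) := by
    refine Finset.sup_le fun j hj x hx => ?_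
    have := Finset.mem_range_succ_iff.1 hj
    rw [LinearMap.mem_ker, gradedProj_of_mem h𝒢 hx, if_neg (by lia)]
  exact hle hc

theorem finiteDimensional_degreeFiltration (hfin : ∀ j, FiniteDimensional k (𝒢 j)) (k0 : ℤ)
    (m : ℕ) : FiniteDimensional k (degreeFiltration 𝒢 k0 m) := by
  induction m with
  | zero => rw [degreeFiltration_zero]; infer_instance
  | succ m ih => rw [degreeFiltration_succ]; infer_instance

theorem finrank_degreeFiltration (h𝒢 : DirectSum.IsInternal 𝒢)
    (hfin : ∀ j, FiniteDimensional k (𝒢 j)) (k0 : ℤ) (m : ℕ) :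
    Module.finrank k (degreeFiltration 𝒢 k0 m) =
      ∑ j ∈ Finset.range (m + 1), Module.finrank k (𝒢 (k0 + j)) := by
  induction m with
  | zero => rw [degreeFiltration_zero, zero_add, Finset.sum_range_one]
  | succ m ih =>
    have := finiteDimensional_degreeFiltration hfin k0 m
    have h := Submodule.finrank_sup_add_finrank_inf_eq (degreeFiltration 𝒢 k0 m)
      (𝒢 (k0 + (m + 1 : ℕ)))
    have hbot : degreeFiltration 𝒢 k0 m ⊓ 𝒢 (k0 + (m + 1 : ℕ)) = ⊥ := by
      rw [Submodule.eq_bot_iff]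
      rintro c ⟨hc, hc'⟩
      rw [← gradedProj_same h𝒢 hc']
      exact gradedProj_degreeFiltration h𝒢 (by push_cast; lia) hc
    rw [hbot, finrank_bot, add_zero, ← degreeFiltration_succ, ih] at h
    rw [h, Finset.sum_range_succ _ (m + 1)]

theorem exists_mem_degreeFiltration (h𝒢 : DirectSum.IsInternal 𝒢) {k0 : ℤ}
    (hk0 : ∀ j < k0, 𝒢 j = ⊥) (c : C) : ∃ m, c ∈ degreeFiltration 𝒢 k0 m := by
  obtain ⟨S, -, hc⟩ := exists_sum_gradedProj h𝒢 c
  refine ⟨S.sup fun i => (i - k0).toNat, ?_⟩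
  rw [hc]
  refine Submodule.sum_mem _ fun i hi => ?_
  rcases lt_or_ge i k0 with h | h
  · have := gradedProj_mem h𝒢 i c
    rw [hk0 i h, Submodule.mem_bot] at this
    rw [this]
    exact zero_mem _
  · have h1 : i = k0 + ((i - k0).toNat : ℕ) := by lia
    have h2 := gradedProj_mem h𝒢 i c
    rw [h1] at h2
    have h3 := le_degreeFiltration (𝒢 := 𝒢) (k0 := k0)
      (Finset.le_sup (f := fun i : ℤ => (i - k0).toNat) hi) h2
    rwa [← h1] at h3

/-- Apply the growth estimates to the filtration by degree, whose dimensions are the partial sums of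
the Hilbert function, and use them to sharpen the Hilbert-Serre exponent n to d. -/
theorem exists_hilbert_numerator {n : ℕ} [Module (MvPolynomial (Fin n) k) C]
    [IsScalarTower k (MvPolynomial (Fin n) k) C] (h𝒢 : DirectSum.IsInternal 𝒢)
    (hX : ∀ (i : Fin n) j, ∀ c ∈ 𝒢 j, mulX k C i c ∈ 𝒢 (j + 1))
    [Module.Finite (MvPolynomial (Fin n) k) C] [Nontrivial C] {k0 : ℤ}
    (hk0 : ∀ j < k0, 𝒢 j = ⊥) :
    ∃ d ≤ n, Module.supportDim (MvPolynomial (Fin n) k) C = (d : ℕ∞) ∧ ∃ b : ℤ[X],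
      (1 - PowerSeries.X) ^ d * PowerSeries.mk (fun m : ℕ =>
        (Module.finrank k (𝒢 (k0 + m)) : ℤ)) = (b : ℤ⟦X⟧) ∧ 0 < b.eval 1 := by
  obtain ⟨F, hF⟩ := (Module.Finite.fg_top : (⊤ : Submodule (MvPolynomial (Fin n) k) C).FG)
  obtain ⟨-, hfin, i1, hi1⟩ := bddBelow_and_finite_of_generated h𝒢
    (T := fun i : Fin n => mulX k C i) hX F fun W hFW hW => by
      refine eq_top_iff.2 fun c _ => ?_
      have hc : c ∈ Submodule.span (MvPolynomial (Fin n) k) (F : Set C) := hF ▸ Submodule.mem_top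
      induction hc using Submodule.span_induction with
      | mem c hc => exact hFW hc
      | zero => exact zero_mem _
      | add x y _ _ hx hy => exact add_mem (hx trivial) (hy trivial)
      | smul a x _ hx => exact smul_mem_of_mulX_mem hW a (hx trivial)
  obtain ⟨d, hd, hdim, φ, ⟨c, hc⟩, r, e, he⟩ := exists_noether_normalization_module (k := k) (n := n) C
  refine ⟨d, hd, hdim, ?_⟩
  have hmono := degreeFiltration_mono (𝒢 := 𝒢) k0
  have hfil := finiteDimensional_degreeFiltration hfin k0
  have hx : ∀ (i : Fin n) m, ∀ c ∈ degreeFiltration 𝒢 k0 m,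
      (MvPolynomial.X i : MvPolynomial (Fin n) k) • c ∈ degreeFiltration 𝒢 k0 (m + 1) := by
    intro i m c hc
    have hle : degreeFiltration 𝒢 k0 m ≤ (degreeFiltration 𝒢 k0 (m + 1)).comap (mulX k C i) := by
      refine Finset.sup_le fun j hj x hx => ?_
      refine le_degreeFiltration (j := j + 1) (by simpa using hj) ?_
      have := hX i _ x hx
      rwa [add_assoc] at this
    exact hle hc
  obtain ⟨A, B, hA, hlow⟩ := pow_le_finrank_filtration hmono hx
    (exists_mem_degreeFiltration h𝒢 hk0) hfil φ hc
  obtain ⟨K, hup⟩ := finrank_filtration_le (m1 := (i1 - k0).toNat) hmono hfil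
    (fun m hm W hW hWx => by
      rw [degreeFiltration_succ]
      refine sup_le hW ?_
      have h1 := hi1 (k0 + m) (by lia)
      rw [add_assoc] at h1
      refine h1.trans (iSup_le fun i => Submodule.map_le_iff_le_comap.2 fun c hc => ?_)
      exact hWx i c (le_degreeFiltration le_rfl hc)) φ he
  obtain ⟨q, hq⟩ := exists_hilbert_serre_numerator h𝒢 hX hfin hk0 Finset.univ ⊥ ⊤ bot_le
    (fun c hc i => by rw [(Submodule.mem_bot _).1 hc, map_zero]; exact zero_mem _)
    (fun _ _ _ => trivial) (fun i hi => absurd (Finset.mem_univ i) hi)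
  have hhom : ∀ i, homRank 𝒢 (⊤ : Submodule (MvPolynomial (Fin n) k) C) i =
      Module.finrank k (𝒢 i) := fun i => by
    rw [homRank, homPart, Submodule.restrictScalars_top, top_inf_eq]
  have hhom' : ∀ i, homRank 𝒢 (⊥ : Submodule (MvPolynomial (Fin n) k) C) i = 0 := fun i => by
    rw [homRank, homPart, Submodule.restrictScalars_bot, bot_inf_eq, finrank_bot]
  simp only [hhom, hhom', Nat.cast_zero, sub_zero, Finset.card_univ, Fintype.card_fin] at hq
  simp only [finrank_degreeFiltration h𝒢 hfin] at hlow hup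
  exact exists_numerator_of_growth (A := A) (B := B) (c := K) hA hd (fun m => Nat.cast_nonneg _) hq
    (fun m => by exact_mod_cast hlow m) (fun m => by exact_mod_cast hup m)

end Dimension

/-! ## A normal form for the algebra `A` -/

section NormalForm

variable {p n : ℕ}

theorem A_induction {P : A p n → Prop} (halg : ∀ r : ZMod p, P (algebraMap (ZMod p) (A p n) r))
    (hgen : ∀ s, P (gen p n s)) (hadd : ∀ a b, P a → P b → P (a + b))
    (hmul : ∀ a b, P a → P b → P (a * b)) (a : A p n) : P a := by
  obtain ⟨b, rfl⟩ := RingQuot.mkAlgHom_surjective (ZMod p) (Rel p n) a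
  induction b using FreeAlgebra.induction with
  | grade0 r => rw [AlgHom.commutes]; exact halg r
  | grade1 s => exact hgen s
  | mul a b ha hb => rw [map_mul]; exact hmul _ _ ha hb
  | add a b ha hb => rw [map_add]; exact hadd _ _ ha hb

theorem xpow_single (i : Fin n) (e : ℕ) : xpow p n (Finsupp.single i e) = x p n i ^ e := by
  have h1 : Finset.noncommProd (Finset.univ.erase i) (fun j => x p n j ^ Finsupp.single i e j)
      (fun i _ j _ _ => (x_commute i j).pow_pow _ _) = 1 :=
    (Finset.noncommProd_eq_pow_card _ _ _ 1 fun j hj => by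
      rw [Finsupp.single_eq_of_ne (Finset.ne_of_mem_erase hj), pow_zero]).trans (one_pow _)
  have h2 := Finset.noncommProd_erase_mul Finset.univ (Finset.mem_univ i)
    (fun j => x p n j ^ Finsupp.single i e j) (fun i _ j _ _ => (x_commute i j).pow_pow _ _)
  refine h2.symm.trans ((congrArg (· * x p n i ^ Finsupp.single i e i) h1).trans ?_)
  simp

theorem polyToA_X (i : Fin n) : polyToA p n (MvPolynomial.X i) = x p n i := by
  rw [MvPolynomial.X, polyToA_monomial, one_smul, xpow_single, pow_one]

/-- The element `b` of `A` put into the summand of `⨁_v A` of index `u`; it is `0` if `u` is not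
an exponent in `{0, …, p-1}^n`. -/
def box (p n : ℕ) (u : Fin n → ℕ) : A p n →ₗ[ZMod p] ((Fin n → Fin p) → A p n) :=
  open scoped Classical in
  if h : ∀ i, u i < p then LinearMap.single (ZMod p) (fun _ => A p n) fun i => ⟨u i, h i⟩ else 0

theorem box_coe (v : Fin n → Fin p) (b : A p n) : box p n (fun i => v i) b = Pi.single v b := by
  rw [box, dif_pos fun i => (v i).2]
  rfl

theorem box_eq_zero {u : Fin n → ℕ} (i : Fin n) (hi : p ≤ u i) : box p n u = 0 := by
  rw [box, dif_neg fun h => (h i).not_ge hi]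

theorem box_ext {M : Type*} [AddCommGroup M] [Module (ZMod p) M]
    {g g' : ((Fin n → Fin p) → A p n) →ₗ[ZMod p] M}
    (h : ∀ u b, g (box p n u b) = g' (box p n u b)) : g = g' :=
  LinearMap.pi_ext fun v b => by
    have := h (fun i => v i) b
    rwa [box_coe] at this

/-- The shift operator on `⨁_v A` that corresponds to the multiplication by `x ^ w`. -/
def shift (p n : ℕ) (w : Fin n → ℕ) :
    ((Fin n → Fin p) → A p n) →ₗ[ZMod p] ((Fin n → Fin p) → A p n) :=
  ∑ v : Fin n → Fin p, box p n ((fun i => (v i : ℕ)) + w) ∘ₗ LinearMap.proj v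

/-- Since `box` vanishes outside the allowed exponents, the rule holds for all u and w, so
commutativity and truncation of the action become arithmetic of exponents. -/
theorem shift_box (w u : Fin n → ℕ) (b : A p n) :
    shift p n w (box p n u b) = box p n (u + w) b := by
  by_cases h : ∀ i, u i < p
  · have hu : u = fun i => ((⟨u i, h i⟩ : Fin p) : ℕ) := rfl
    rw [hu, box_coe, shift, LinearMap.sum_apply, Finset.sum_eq_single fun i => (⟨u i, h i⟩ : Fin p)]
    · simp
    · intro v _ hv
      simp [Pi.single_eq_of_ne hv]
    · simp
  · push Not at h
    obtain ⟨i, hi⟩ := h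
    rw [box_eq_zero i hi, box_eq_zero i (hi.trans (Nat.le_add_right _ _))]
    simp

/-- The representation space `R ⊕ ⨁_v A`, which turns out to be `A` itself. -/
abbrev NormalForm (p n : ℕ) : Type :=
  MvPolynomial (Fin n) (ZMod p) × ((Fin n → Fin p) → A p n)

/-- The map `⨁_v A → A` that is multiplication by `x ^ v f` on the summand of index `v`. -/
def boxSum (p n : ℕ) : ((Fin n → Fin p) → A p n) →ₗ[ZMod p] A p n := structureMap p n (A p n)

theorem boxSum_box (u : Fin n → ℕ) (b : A p n) :
    boxSum p n (box p n u b) = xpow p n u * f p n * b := by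
  by_cases h : ∀ i, u i < p
  · have hu : u = fun i => ((⟨u i, h i⟩ : Fin p) : ℕ) := rfl
    rw [hu, box_coe, boxSum, structureMap_apply,
      Finset.sum_eq_single fun i => (⟨u i, h i⟩ : Fin p)]
    · simp
    · intro v _ hv
      simp [Pi.single_eq_of_ne hv]
    · simp
  · push Not at h
    obtain ⟨i, hi⟩ := h
    rw [box_eq_zero i hi, xpow_mul_f_eq_zero u i hi]
    simp

/-- The evaluation map `R ⊕ ⨁_v A → A`. -/
def evalForm (p n : ℕ) : NormalForm p n →ₗ[ZMod p] A p n :=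
  (polyToA p n).toLinearMap.coprod (boxSum p n)

theorem evalForm_mk (r : MvPolynomial (Fin n) (ZMod p)) (a : (Fin n → Fin p) → A p n) :
    evalForm p n (r, a) = polyToA p n r + boxSum p n a := rfl

/-- The action of a generator of `A` on `R ⊕ ⨁_v A`. -/
def genAct (p n : ℕ) : Fin n ⊕ Unit → Module.End (ZMod p) (NormalForm p n)
  | Sum.inl i => LinearMap.prodMap (LinearMap.mulLeft (ZMod p) (MvPolynomial.X i))
      (shift p n (Finsupp.single i 1))
  | Sum.inr _ => LinearMap.inr _ _ _ ∘ₗ box p n 0 ∘ₗ evalForm p n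

theorem genAct_x (i : Fin n) (r : MvPolynomial (Fin n) (ZMod p)) (a : (Fin n → Fin p) → A p n) :
    genAct p n (Sum.inl i) (r, a) =
      (MvPolynomial.X i * r, shift p n (Finsupp.single i 1) a) := rfl

theorem genAct_f (m : NormalForm p n) :
    genAct p n (Sum.inr ()) m = (0, box p n 0 (evalForm p n m)) := rfl

theorem genAct_x_pow_box (i : Fin n) (e : ℕ) (u : Fin n → ℕ) (b : A p n) :
    (genAct p n (Sum.inl i) ^ e) (0, box p n u b) =
      (0, box p n (u + Finsupp.single i e) b) := by
  induction e with
  | zero => simp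
  | succ e ih =>
    rw [pow_succ', Module.End.mul_apply, ih, genAct_x, mul_zero, shift_box, add_assoc,
      ← Finsupp.coe_add, ← Finsupp.single_add]

theorem genAct_x_commute (i j : Fin n) :
    genAct p n (Sum.inl i) * genAct p n (Sum.inl j) =
      genAct p n (Sum.inl j) * genAct p n (Sum.inl i) := by
  have h : shift p n (Finsupp.single i 1) ∘ₗ shift p n (Finsupp.single j 1) =
      shift p n (Finsupp.single j 1) ∘ₗ shift p n (Finsupp.single i 1) := box_ext fun u b => by
    simp only [LinearMap.comp_apply, shift_box]
    rw [add_right_comm]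
  refine LinearMap.ext fun ⟨r, a⟩ => ?_
  simp only [Module.End.mul_apply, genAct_x]
  exact Prod.ext (mul_left_comm _ _ _) (DFunLike.congr_fun h a)

/-- The representation of `A` on `R ⊕ ⨁_v A`. -/
def formRep (p n : ℕ) : A p n →ₐ[ZMod p] Module.End (ZMod p) (NormalForm p n) :=
  RingQuot.liftAlgHom (ZMod p) ⟨FreeAlgebra.lift (ZMod p) (genAct p n), by
    intro a b h
    cases h with
    | comm i j =>
      simp only [map_mul, FreeAlgebra.lift_ι_apply]
      exact genAct_x_commute i j
    | trunc i =>
      simp only [map_mul, map_pow, map_zero, FreeAlgebra.lift_ι_apply]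
      refine LinearMap.ext fun m => ?_
      -- The action of f lands in the summand of exponent 0, and p shifts in direction i leave the
      -- range of exponents.
      rw [Module.End.mul_apply, genAct_f, genAct_x_pow_box, box_eq_zero i (by simp)]
      rfl⟩

theorem formRep_gen (s : Fin n ⊕ Unit) : formRep p n (gen p n s) = genAct p n s := by
  rw [formRep, gen, RingQuot.liftAlgHom_mkAlgHom_apply, FreeAlgebra.lift_ι_apply]

theorem formRep_xpow_box (w : Fin n →₀ ℕ) (u : Fin n → ℕ) (b : A p n) :
    formRep p n (xpow p n w) (0, box p n u b) = (0, box p n (u + w) b) := by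
  induction w using Finsupp.induction_linear generalizing u with
  | zero =>
    rw [Finsupp.coe_zero, xpow_zero, map_one, add_zero]
    rfl
  | add w w' hw hw' =>
    rw [Finsupp.coe_add, xpow_add, map_mul, Module.End.mul_apply, hw', hw, add_assoc,
      add_comm (w' : Fin n → ℕ)]
  | single i e =>
    rw [xpow_single, map_pow, x, formRep_gen, genAct_x_pow_box]

/-- Linearity of the evaluation over A; at m = (1, 0) it shows that b ↦ b · (1, 0) is a section of
the evaluation. -/
theorem evalForm_formRep (a : A p n) (m : NormalForm p n) :
    evalForm p n (formRep p n a m) = a * evalForm p n m := by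
  induction a using A_induction generalizing m with
  | halg r =>
    rw [AlgHom.commutes, Module.algebraMap_end_apply, map_smul, Algebra.smul_def]
  | hadd a b ha hb => rw [map_add, LinearMap.add_apply, map_add, ha, hb, add_mul]
  | hmul a b ha hb => rw [map_mul, Module.End.mul_apply, ha, hb, mul_assoc]
  | hgen s =>
    rw [formRep_gen]
    rcases s with i | ⟨⟩
    · obtain ⟨r, a⟩ := m
      have h : boxSum p n ∘ₗ shift p n (Finsupp.single i 1) =
          LinearMap.mulLeft (ZMod p) (x p n i) ∘ₗ boxSum p n := box_ext fun u b => by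
        simp only [LinearMap.comp_apply, shift_box, boxSum_box, LinearMap.mulLeft_apply]
        rw [add_comm, xpow_add, xpow_single, pow_one, mul_assoc, mul_assoc, mul_assoc]
      have h' := DFunLike.congr_fun h a
      simp only [LinearMap.comp_apply, LinearMap.mulLeft_apply] at h'
      rw [genAct_x, evalForm_mk, evalForm_mk, h', map_mul, polyToA_X, mul_add, x]
    · rw [genAct_f, evalForm_mk, map_zero, zero_add, boxSum_box, xpow_zero, one_mul, f]

/-- Acting on (1, 0), the element x^v f a_v gives a_v in the summand v: f stores the evaluation of
a_v · (1, 0), which is a_v, and x^v shifts it into place. So the sum of the x^v f a_v determines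
every a_v. -/
theorem boxSum_injective : Function.Injective (boxSum p n) := by
  refine (injective_iff_map_eq_zero _).2 fun a ha => ?_
  have h1 : ∀ b : A p n, evalForm p n (formRep p n b (1, 0)) = b := fun b => by
    rw [evalForm_formRep, evalForm_mk, map_one, map_zero, add_zero, mul_one]
  have h2 : ∀ v : Fin n → Fin p,
      formRep p n (xpow p n (fun i => (v i : ℕ)) * f p n * a v) (1, 0) = (0, Pi.single v (a v)) := by
    intro v
    rw [map_mul, map_mul, Module.End.mul_apply, Module.End.mul_apply, f, formRep_gen, genAct_f, h1]
    have := formRep_xpow_box (Finsupp.equivFunOnFinite.symm fun i => (v i : ℕ)) 0 (a v)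
    rw [zero_add] at this
    rw [← box_coe]
    exact this
  have h3 : boxSum p n a = ∑ v, xpow p n (fun i => (v i : ℕ)) * f p n * a v :=
    structureMap_apply p n (A p n) a
  have h4 := congrArg (fun b => (formRep p n b (1, 0)).2) (h3.symm.trans ha)
  simp only [map_sum, LinearMap.sum_apply, h2, map_zero, LinearMap.zero_apply, Prod.snd_sum,
    Prod.snd_zero] at h4
  rwa [Finset.univ_sum_single] at h4

theorem structureMap_pi_injective (m : ℕ) :
    Function.Injective (structureMap p n (Fin m → A p n)) := by
  refine (injective_iff_map_eq_zero _).2 fun g hg => ?_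
  funext v j
  have h : boxSum p n (fun v => g v j) = 0 := by
    have h1 : boxSum p n (fun v => g v j) = _ := structureMap_apply p n (A p n) _
    have h2 := congrFun ((structureMap_apply p n (Fin m → A p n) g).symm.trans hg) j
    rw [Finset.sum_apply] at h2
    exact h1.trans h2
  exact congrFun (boxSum_injective (h.trans (map_zero _).symm)) v

end NormalForm

/-! ## Kernel and cokernel of the structure map -/

theorem finiteDimensional_of_pow_smul_eq_zero {k : Type*} [Field k] {p n : ℕ} (T : Type*)
    [AddCommGroup T] [Module k T] [Module (MvPolynomial (Fin n) k) T]
    [IsScalarTower k (MvPolynomial (Fin n) k) T] [Module.Finite (MvPolynomial (Fin n) k) T]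
    (hT : ∀ (i : Fin n) (c : T), (MvPolynomial.X i ^ p : MvPolynomial (Fin n) k) • c = 0) :
    FiniteDimensional k T := by
  obtain ⟨F, hF⟩ := (Module.Finite.fg_top : (⊤ : Submodule (MvPolynomial (Fin n) k) T).FG)
  let m : (Fin n → Fin p) × F → T := fun q =>
    MvPolynomial.monomial (Finsupp.equivFunOnFinite.symm fun i => (q.1 i : ℕ)) (1 : k) • (q.2 : T)
  set W := Submodule.span k (Set.range m)
  have h1 : ∀ (u : Fin n →₀ ℕ) (c : F), MvPolynomial.monomial u (1 : k) • (c : T) ∈ W := by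
    intro u c
    by_cases h : ∀ i, u i < p
    · refine Submodule.subset_span ⟨(fun i => ⟨u i, h i⟩, c), ?_⟩
      simp only [m]
      congr 2
      ext i
      simp
    · push Not at h
      obtain ⟨i, hi⟩ := h
      have hu : u = (u - Finsupp.single i p) + Finsupp.single i p :=
        (tsub_add_cancel_of_le (Finsupp.single_le_iff.2 hi)).symm
      rw [hu, ← one_mul (1 : k), ← MvPolynomial.monomial_mul, ← MvPolynomial.X_pow_eq_monomial,
        mul_smul, hT, smul_zero]
      exact zero_mem _
  have h2 : ∀ (a : MvPolynomial (Fin n) k) (c : F), a • (c : T) ∈ W := by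
    intro a c
    rw [a.as_sum, Finset.sum_smul]
    refine Submodule.sum_mem _ fun u _ => ?_
    have h3 : MvPolynomial.monomial u (a.coeff u) = a.coeff u • MvPolynomial.monomial u (1 : k) := by
      rw [MvPolynomial.smul_monomial, smul_eq_mul, mul_one]
    rw [h3, smul_assoc]
    exact W.smul_mem _ (h1 u c)
  have htop : W = ⊤ := by
    refine eq_top_iff.2 fun c _ => ?_
    have hc : c ∈ Submodule.span (MvPolynomial (Fin n) k) (F : Set T) := hF ▸ Submodule.mem_top
    obtain ⟨a, ha⟩ := Submodule.mem_span_finset.1 hc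
    rw [← ha.2]
    exact Submodule.sum_mem _ fun c hc => h2 (a c) ⟨c, hc⟩
  have := FiniteDimensional.span_of_finite k (Set.finite_range m)
  exact Module.finite_def.2 (htop ▸ (Submodule.fg_iff_finiteDimensional W).2 this)

section Cokernel

variable {p n : ℕ} {N : Type*} [AddCommGroup N] [Module (A p n) N]
  [Module (ZMod p) N] [IsScalarTower (ZMod p) (A p n) N]

theorem smul_mem_of_gen_smul_mem {W : Submodule (ZMod p) N} (hW : ∀ s, ∀ m ∈ W, gen p n s • m ∈ W)
    (a : A p n) {m : N} (hm : m ∈ W) : a • m ∈ W := by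
  induction a using A_induction generalizing m with
  | halg r => rw [algebraMap_smul]; exact W.smul_mem r hm
  | hgen s => exact hW s m hm
  | hadd a b ha hb => rw [add_smul]; exact add_mem (ha hm) (hb hm)
  | hmul a b ha hb => rw [mul_smul]; exact ha (hb hm)

variable (p n N) in
instance cokernelModule : Module (ZMod p) (StructuralCokernel p n N) :=
  Module.compHom _ (MvPolynomial.C : ZMod p →+* MvPolynomial (Fin n) (ZMod p))

instance : IsScalarTower (ZMod p) (MvPolynomial (Fin n) (ZMod p)) (StructuralCokernel p n N) where
  smul_assoc r a c := by
    rw [MvPolynomial.smul_eq_C_mul, mul_smul]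
    rfl

variable (p n N) in
/-- The projection of `N` onto the structural cokernel. -/
def toCokernel : N →ₗ[ZMod p] StructuralCokernel p n N :=
  letI := polyModule p n N
  { toFun := (structureImage p n N).mkQ
    map_add' := map_add _
    map_smul' := fun r m => by
      have h : r • m = (MvPolynomial.C r : MvPolynomial (Fin n) (ZMod p)) • m := by
        change r • m = polyToA p n (algebraMap _ _ r) • m
        rw [AlgHom.commutes, algebraMap_smul]
      rw [h, map_smul]
      rfl }

theorem toCokernel_surjective : Function.Surjective (toCokernel p n N) :=
  letI := polyModule p n N
  Submodule.mkQ_surjective (structureImage p n N)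

theorem toCokernel_eq_zero {m : N} :
    toCokernel p n N m = 0 ↔ m ∈ LinearMap.range (structureMap p n N) :=
  letI := polyModule p n N
  Submodule.Quotient.mk_eq_zero (structureImage p n N)

theorem smul_toCokernel (a : MvPolynomial (Fin n) (ZMod p)) (m : N) :
    a • toCokernel p n N m = toCokernel p n N (polyToA p n a • m) := rfl

theorem toCokernel_f_smul (m : N) : toCokernel p n N (f p n • m) = 0 := by
  have := xpow_f_smul_mem p n N 0 m
  rw [xpow_zero, one_mul] at this
  exact toCokernel_eq_zero.2 this

theorem X_pow_smul_structureMap (i : Fin n) (g : (Fin n → Fin p) → N) :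
    (polyToA p n (MvPolynomial.X i ^ p)) • structureMap p n N g = 0 := by
  rw [structureMap_apply, Finset.smul_sum]
  refine Finset.sum_eq_zero fun v _ => ?_
  rw [← mul_smul, ← mul_assoc, map_pow, polyToA_X, ← xpow_single, ← xpow_add,
    xpow_mul_f_eq_zero _ i (by simp), zero_smul]

/-- Generators over A also generate the cokernel over R: f acts as zero there, so the R-span of
their classes is stable under all generators of A. -/
theorem finite_structuralCokernel [Module.Finite (A p n) N] :
    Module.Finite (MvPolynomial (Fin n) (ZMod p)) (StructuralCokernel p n N) := by
  classical
  obtain ⟨F, hF⟩ := (Module.Finite.fg_top : (⊤ : Submodule (A p n) N).FG)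
  let S : Submodule (MvPolynomial (Fin n) (ZMod p)) (StructuralCokernel p n N) :=
    Submodule.span _ (F.image (toCokernel p n N) : Set (StructuralCokernel p n N))
  let W : Submodule (ZMod p) N := (S.restrictScalars (ZMod p)).comap (toCokernel p n N)
  have hW : ∀ s, ∀ m ∈ W, gen p n s • m ∈ W := by
    rintro (i | ⟨⟩) m hm
    · change toCokernel p n N (x p n i • m) ∈ S
      rw [← polyToA_X, ← smul_toCokernel]
      exact S.smul_mem _ hm
    · change toCokernel p n N (f p n • m) ∈ S
      rw [toCokernel_f_smul]
      exact zero_mem _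
  refine ⟨⟨F.image (toCokernel p n N), eq_top_iff.2 fun c _ => ?_⟩⟩
  obtain ⟨m, rfl⟩ := toCokernel_surjective c
  have hm : m ∈ Submodule.span (A p n) (F : Set N) := hF ▸ Submodule.mem_top
  change m ∈ W
  induction hm using Submodule.span_induction with
  | mem m hm => exact Submodule.subset_span (Finset.mem_coe.2 (Finset.mem_image_of_mem _ hm))
  | zero => exact zero_mem _
  | add y z _ _ hy hz => exact add_mem (hy trivial) (hz trivial)
  | smul a y _ hy => exact smul_mem_of_gen_smul_mem hW a (hy trivial)

theorem structureMap_comp {N' : Type*} [AddCommGroup N'] [Module (A p n) N'] [Module (ZMod p) N']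
    [IsScalarTower (ZMod p) (A p n) N'] (l : N →ₗ[A p n] N') (g : (Fin n → Fin p) → N) :
    structureMap p n N' (fun v => l (g v)) = l (structureMap p n N g) := by
  rw [structureMap_apply, structureMap_apply, map_sum]
  exact Finset.sum_congr rfl fun v _ => (map_smul l _ _).symm

/-- The elements of the structural cokernel that are killed by all `x_i ^ p`. -/
def cokernelTorsion (p n : ℕ) (N : Type*) [AddCommGroup N] [Module (A p n) N] [Module (ZMod p) N]
    [IsScalarTower (ZMod p) (A p n) N] :
    Submodule (MvPolynomial (Fin n) (ZMod p)) (StructuralCokernel p n N) :=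
  ⨅ i, LinearMap.ker (LinearMap.lsmul (MvPolynomial (Fin n) (ZMod p)) (StructuralCokernel p n N)
    (MvPolynomial.X i ^ p))

theorem mem_cokernelTorsion {c : StructuralCokernel p n N} :
    c ∈ cokernelTorsion p n N ↔
      ∀ i, (MvPolynomial.X i ^ p : MvPolynomial (Fin n) (ZMod p)) • c = 0 := by
  simp [cokernelTorsion]

theorem finiteDimensional_cokernelTorsion [Fact p.Prime] [Module.Finite (A p n) N] :
    FiniteDimensional (ZMod p) (cokernelTorsion p n N) := by
  have := finite_structuralCokernel (p := p) (n := n) (N := N)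
  have : IsNoetherian (MvPolynomial (Fin n) (ZMod p)) (StructuralCokernel p n N) :=
    isNoetherian_of_isNoetherianRing_of_finite _ _
  exact finiteDimensional_of_pow_smul_eq_zero (p := p) (n := n) _ fun i c =>
    Subtype.ext (mem_cokernelTorsion.1 c.2 i)

/-- The kernel of the structure map embeds into the part of the structural cokernel of a syzygy
module that is killed by all `x_i ^ p`. -/
theorem finiteDimensional_ker_structureMap_of_exact [Fact p.Prime] {F K : Type*} [AddCommGroup F]
    [Module (A p n) F] [Module (ZMod p) F] [IsScalarTower (ZMod p) (A p n) F] [AddCommGroup K]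
    [Module (A p n) K] [Module (ZMod p) K] [IsScalarTower (ZMod p) (A p n) K]
    [Module.Finite (A p n) K] {j : K →ₗ[A p n] F} {l : F →ₗ[A p n] N}
    (hj : Function.Injective j) (hjl : ∀ z, l z = 0 ↔ ∃ w, j w = z) (hl : Function.Surjective l)
    (hF : Function.Injective (structureMap p n F)) :
    FiniteDimensional (ZMod p) (LinearMap.ker (structureMap p n N)) := by
  -- Snake lemma by hand. Tuples z with Θ_F z ∈ K map onto ker Θ_N by `E` and into C_K by `D`;
  -- injectivity of Θ_F gives ker D ≤ ker E, so ker Θ_N is a quotient of the range of D.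
  let L : Submodule (ZMod p) ((Fin n → Fin p) → F) :=
    LinearMap.ker (l.restrictScalars (ZMod p) ∘ₗ structureMap p n F)
  obtain ⟨ΘL, hΘ⟩ : ∃ ΘL : L →ₗ[ZMod p] K, ∀ z, j (ΘL z) = structureMap p n F z := by
    choose w hw using fun z : L => (hjl _).1 (LinearMap.mem_ker.1 z.2)
    refine ⟨⟨⟨w, fun z z' => hj ?_⟩, fun r z => hj ?_⟩, hw⟩
    · rw [map_add, hw, hw, hw, Submodule.coe_add, map_add]
    · rw [LinearMap.map_smul_of_tower]
      exact (hw _).trans ((map_smul _ _ _).trans (congrArg _ (hw z).symm))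
  let D : L →ₗ[ZMod p] StructuralCokernel p n K := toCokernel p n K ∘ₗ ΘL
  let E : L →ₗ[ZMod p] LinearMap.ker (structureMap p n N) :=
    LinearMap.codRestrict _
      ((LinearMap.compLeft (l.restrictScalars (ZMod p)) (Fin n → Fin p)) ∘ₗ L.subtype) fun z =>
        (structureMap_comp l z.1).trans z.2
  have hE : Function.Surjective E := by
    rintro ⟨y, hy⟩
    choose z hz using fun v => hl (y v)
    have hzL : z ∈ L := by
      refine (structureMap_comp l z).symm.trans ?_
      simp only [hz]
      exact hy
    exact ⟨⟨z, hzL⟩, Subtype.ext (funext hz)⟩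
  have hker : LinearMap.ker D ≤ LinearMap.ker E := by
    intro z hz
    have hz' : toCokernel p n K (ΘL z) = 0 := hz
    obtain ⟨w, hw⟩ := toCokernel_eq_zero.1 hz'
    have h1 : structureMap p n F (fun v => j (w v)) = structureMap p n F z := by
      rw [structureMap_comp, hw, hΘ]
    have h2 := hF h1
    refine LinearMap.mem_ker.2 (Subtype.ext (funext fun v => ?_))
    change l (z.1 v) = 0
    rw [hjl, ← h2]
    exact ⟨w v, rfl⟩
  have hD : LinearMap.range D ≤ (cokernelTorsion p n K).restrictScalars (ZMod p) := by
    rintro _ ⟨z, rfl⟩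
    refine mem_cokernelTorsion.2 fun i => ?_
    have h1 : polyToA p n (MvPolynomial.X i ^ p) • ΘL z = 0 := by
      apply hj
      rw [map_smul, hΘ, X_pow_smul_structureMap, map_zero]
    have h2 := smul_toCokernel (MvPolynomial.X i ^ p : MvPolynomial (Fin n) (ZMod p)) (ΘL z)
    rw [h1, map_zero] at h2
    exact h2
  have : FiniteDimensional (ZMod p) ((cokernelTorsion p n K).restrictScalars (ZMod p)) :=
    finiteDimensional_cokernelTorsion
  have : FiniteDimensional (ZMod p) (LinearMap.range D) := Submodule.finiteDimensional_of_le hD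
  have : Module.Finite (ZMod p) (L ⧸ LinearMap.ker D) :=
    Module.Finite.equiv D.quotKerEquivRange.symm
  refine Module.Finite.of_surjective ((LinearMap.ker D).liftQ E hker) ?_
  intro y
  obtain ⟨z, rfl⟩ := hE y
  exact ⟨Submodule.Quotient.mk z, rfl⟩

/-- Finite presentation enters here: the syzygy module K must be finitely generated for its
structural cokernel to be noetherian over R. -/
theorem finiteDimensional_ker_structureMap [Fact p.Prime]
    (hN : Module.FinitePresentation (A p n) N) :
    FiniteDimensional (ZMod p) (LinearMap.ker (structureMap p n N)) := by
  obtain ⟨m, K, e, hK⟩ := Module.FinitePresentation.exists_fin (A p n) N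
  have : Module.Finite (A p n) K := Module.Finite.iff_fg.2 hK
  exact finiteDimensional_ker_structureMap_of_exact (K := K) (F := Fin m → A p n) (j := K.subtype)
    (l := e.symm.toLinearMap ∘ₗ K.mkQ) K.injective_subtype (fun z => by simp)
    (e.symm.surjective.comp K.mkQ_surjective) (structureMap_pi_injective m)

end Cokernel

/-! ## Counting dimensions degree by degree -/

section Counting

variable {p n : ℕ} {N : Type*} [AddCommGroup N] [Module (A p n) N]
  [Module (ZMod p) N] {𝒩 : ℤ → Submodule (ZMod p) N}

theorem gen_smul_mem (h𝒩 : IsGradedModule p n N 𝒩) (s : Fin n ⊕ Unit) {j : ℤ} {m : N}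
    (hm : m ∈ 𝒩 j) : gen p n s • m ∈ 𝒩 (j + 1) := by
  have := h𝒩.smul_mem 1 j (gen p n s) m (by
    rw [degreePart, pow_one]
    exact Submodule.subset_span ⟨s, rfl⟩) hm
  rwa [Nat.cast_one, add_comm] at this

theorem xpow_smul_mem (h𝒩 : IsGradedModule p n N 𝒩) (w : Fin n →₀ ℕ) {j : ℤ} {m : N}
    (hm : m ∈ 𝒩 j) : xpow p n w • m ∈ 𝒩 (j + w.degree) := by
  induction w using Finsupp.induction_linear generalizing j m with
  | zero => simpa [xpow_zero] using hm
  | add w w' hw hw' =>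
    rw [Finsupp.coe_add, xpow_add, mul_smul, map_add, Nat.cast_add, add_comm (w.degree : ℤ),
      ← add_assoc]
    exact hw (hw' hm)
  | single i e =>
    rw [xpow_single, Finsupp.degree_single]
    induction e with
    | zero => simpa using hm
    | succ e ih =>
      rw [pow_succ', mul_smul, Nat.cast_succ, ← add_assoc]
      exact gen_smul_mem h𝒩 _ ih

variable [IsScalarTower (ZMod p) (A p n) N] [Fact p.Prime]

variable (N) in
/-- Multiplication by `x ^ v f`. -/
def mulBox (v : Fin n → Fin p) : N →ₗ[ZMod p] N :=
  Algebra.lsmul (ZMod p) (ZMod p) N (xpow p n (fun i => (v i : ℕ)) * f p n)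

theorem structureMap_eq_sum (g : (Fin n → Fin p) → N) :
    structureMap p n N g = ∑ v, mulBox N v (g v) := by
  simp [structureMap, mulBox]

/-- The degree of `x ^ v f`. -/
def boxDegree (v : Fin n → Fin p) : ℕ := ∑ i, (v i : ℕ) + 1

theorem mulBox_mem (h𝒩 : IsGradedModule p n N 𝒩) (v : Fin n → Fin p) {j : ℤ} {m : N}
    (hm : m ∈ 𝒩 j) : mulBox N v m ∈ 𝒩 (j + boxDegree v) := by
  have h1 := xpow_smul_mem h𝒩 (Finsupp.equivFunOnFinite.symm fun i => (v i : ℕ))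
    (gen_smul_mem h𝒩 (Sum.inr ()) hm)
  have h2 : ((boxDegree v : ℕ) : ℤ) =
      1 + ((Finsupp.equivFunOnFinite.symm fun i => (v i : ℕ)).degree : ℕ) := by
    rw [Finsupp.degree_eq_sum, boxDegree]
    simp [add_comm]
  rw [h2, ← add_assoc]
  rw [← mul_smul] at h1
  exact h1

theorem gradedProj_structureMap (h𝒩 : IsGradedModule p n N 𝒩) (i : ℤ)
    (g : (Fin n → Fin p) → N) :
    gradedProj h𝒩.isInternal i (structureMap p n N g) =
      structureMap p n N fun v => gradedProj h𝒩.isInternal (i - boxDegree v) (g v) := by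
  rw [structureMap_eq_sum, structureMap_eq_sum, map_sum]
  refine Finset.sum_congr rfl fun v _ => ?_
  have := gradedProj_map h𝒩.isInternal h𝒩.isInternal (T := mulBox N v) (a := boxDegree v)
    (fun j m hm => mulBox_mem h𝒩 v hm) (i - boxDegree v) (g v)
  rwa [sub_add_cancel] at this

/-- The grading of the structural cokernel. -/
def cokernelGrading (𝒩 : ℤ → Submodule (ZMod p) N) (i : ℤ) :
    Submodule (ZMod p) (StructuralCokernel p n N) :=
  (𝒩 i).map (toCokernel p n N)

/-- The dimensions of the components of a graded vector space. -/
def hilbertFunction {k M : Type*} [Field k] [AddCommGroup M] [Module k M]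
    (𝒢 : ℤ → Submodule k M) (i : ℤ) : ℕ :=
  Module.finrank k (𝒢 i)

theorem isInternal_cokernelGrading (h𝒩 : IsGradedModule p n N 𝒩) :
    DirectSum.IsInternal (cokernelGrading (p := p) (n := n) 𝒩) :=
  isInternal_map_of_surjective h𝒩.isInternal toCokernel_surjective fun m hm i => by
    obtain ⟨g, rfl⟩ := toCokernel_eq_zero.1 hm
    rw [gradedProj_structureMap h𝒩]
    exact toCokernel_eq_zero.2 ⟨_, rfl⟩

theorem mulX_mem_cokernelGrading (h𝒩 : IsGradedModule p n N 𝒩) (i : Fin n) (j : ℤ)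
    (c : StructuralCokernel p n N) (hc : c ∈ cokernelGrading 𝒩 j) :
    mulX (ZMod p) (StructuralCokernel p n N) i c ∈ cokernelGrading 𝒩 (j + 1) := by
  obtain ⟨m, hm, rfl⟩ := hc
  rw [mulX_apply, smul_toCokernel, polyToA_X]
  exact ⟨_, gen_smul_mem h𝒩 _ hm, rfl⟩

theorem bddBelow_and_finite (h𝒩 : IsGradedModule p n N 𝒩) [Module.Finite (A p n) N] :
    (∃ k0 : ℤ, ∀ j < k0, 𝒩 j = ⊥) ∧ ∀ j, FiniteDimensional (ZMod p) (𝒩 j) := by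
  obtain ⟨F, hF⟩ := (Module.Finite.fg_top : (⊤ : Submodule (A p n) N).FG)
  obtain ⟨h1, h2, -⟩ := bddBelow_and_finite_of_generated h𝒩.isInternal
    (T := fun s => Algebra.lsmul (ZMod p) (ZMod p) N (gen p n s))
    (fun s j m hm => gen_smul_mem h𝒩 s hm) F fun W hFW hW => by
      refine eq_top_iff.2 fun m _ => ?_
      have hm : m ∈ Submodule.span (A p n) (F : Set N) := hF ▸ Submodule.mem_top
      induction hm using Submodule.span_induction with
      | mem m hm => exact hFW hm
      | zero => exact zero_mem _
      | add x y _ _ hx hy => exact add_mem (hx trivial) (hy trivial)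
      | smul a x _ hx => exact smul_mem_of_gen_smul_mem hW a (hx trivial)
  exact ⟨h1, h2⟩

theorem exists_injective_in_large_degrees (h𝒩 : IsGradedModule p n N 𝒩)
    (hN : Module.FinitePresentation (A p n) N) :
    ∃ I : ℤ, ∀ i ≥ I, ∀ g : (Fin n → Fin p) → N, (∀ v, g v ∈ 𝒩 (i - boxDegree v)) →
      structureMap p n N g = 0 → g = 0 := by
  classical
  have := finiteDimensional_ker_structureMap hN
  obtain ⟨F, hF⟩ := (Submodule.fg_iff_finiteDimensional
    (LinearMap.ker (structureMap p n N))).2 this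
  choose S hS _ using exists_sum_gradedProj h𝒩.isInternal
  obtain ⟨I, hI⟩ := (F.biUnion fun g => Finset.univ.biUnion fun v => S (g v)).bddAbove
  -- Beyond this bound i - `boxDegree v` exceeds I for every v at once, where I bounds all degrees
  -- occurring in a finite spanning set of the kernel.
  refine ⟨I + 1 + ∑ v : Fin n → Fin p, boxDegree v, fun i hi g hg hg0 => ?_⟩
  funext v
  have hv : (boxDegree v : ℤ) ≤ ∑ v : Fin n → Fin p, (boxDegree v : ℤ) :=
    Finset.single_le_sum (f := fun v : Fin n → Fin p => (boxDegree v : ℤ))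
      (fun _ _ => Nat.cast_nonneg _) (Finset.mem_univ v)
  have hle : LinearMap.ker (structureMap p n N) ≤ LinearMap.ker
      (gradedProj h𝒩.isInternal (i - boxDegree v) ∘ₗ LinearMap.proj v) := by
    rw [← hF, Submodule.span_le]
    intro g' hg'
    refine hS (g' v) _ fun hmem => ?_
    have := hI (Finset.mem_coe.2 (Finset.mem_biUnion.2 ⟨g', hg',
      Finset.mem_biUnion.2 ⟨v, Finset.mem_univ v, hmem⟩⟩))
    push_cast at hi
    lia
  have h0 : gradedProj h𝒩.isInternal (i - boxDegree v) (g v) = 0 := hle hg0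
  rwa [gradedProj_same _ (hg v)] at h0

theorem structureMap_mem (h𝒩 : IsGradedModule p n N 𝒩) {i : ℤ} {g : (Fin n → Fin p) → N}
    (hg : ∀ v, g v ∈ 𝒩 (i - boxDegree v)) : structureMap p n N g ∈ 𝒩 i := by
  rw [structureMap_eq_sum]
  refine Submodule.sum_mem _ fun v _ => ?_
  have := mulBox_mem h𝒩 v (hg v)
  rwa [sub_add_cancel] at this

theorem exists_homogeneous_preimage (h𝒩 : IsGradedModule p n N 𝒩) {i : ℤ} {m : N} (hm : m ∈ 𝒩 i)
    (hm0 : toCokernel p n N m = 0) :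
    ∃ g : (Fin n → Fin p) → N, (∀ v, g v ∈ 𝒩 (i - boxDegree v)) ∧ structureMap p n N g = m := by
  obtain ⟨g, hg⟩ := toCokernel_eq_zero.1 hm0
  refine ⟨_, fun v => gradedProj_mem h𝒩.isInternal (i - boxDegree v) (g v), ?_⟩
  rw [← gradedProj_structureMap h𝒩, hg, gradedProj_same _ hm]

/-- Rank-nullity for the projection of the degree i part of N to the cokernel; its kernel is the
degree i part of the image of Θ_N, on whose source Θ_N is injective for large i. -/
theorem exists_hilbertFunction_eq (h𝒩 : IsGradedModule p n N 𝒩)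
    (hN : Module.FinitePresentation (A p n) N) :
    ∃ I : ℤ, ∀ i ≥ I, hilbertFunction 𝒩 i = hilbertFunction (cokernelGrading (n := n) 𝒩) i +
      ∑ v : Fin n → Fin p, hilbertFunction 𝒩 (i - boxDegree v) := by
  have : Module.Finite (A p n) N := inferInstance
  obtain ⟨-, hfin⟩ := bddBelow_and_finite h𝒩
  obtain ⟨I, hI⟩ := exists_injective_in_large_degrees h𝒩 hN
  refine ⟨I, fun i hi => ?_⟩
  let ψ : (∀ v : Fin n → Fin p, 𝒩 (i - boxDegree v)) →ₗ[ZMod p] N := structureMap p n N ∘ₗ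
    LinearMap.pi fun v => (𝒩 (i - boxDegree v)).subtype ∘ₗ LinearMap.proj v
  have hψ : ∀ g, ψ g = structureMap p n N fun v => g v := fun g => rfl
  have hinj : Function.Injective ψ := (injective_iff_map_eq_zero _).2 fun g hg => by
    have := hI i hi _ (fun v => (g v).2) ((hψ g).symm.trans hg)
    funext v
    exact Subtype.ext (congrFun this v)
  have hrange : LinearMap.range ψ = (LinearMap.ker (toCokernel p n N ∘ₗ (𝒩 i).subtype)).map
      (𝒩 i).subtype := by
    clear_value ψ
    apply le_antisymm
    · rintro _ ⟨g, rfl⟩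
      have hmem : ψ g ∈ 𝒩 i := by
        rw [hψ]
        exact structureMap_mem h𝒩 fun v => (g v).2
      refine ⟨⟨ψ g, hmem⟩, ?_, rfl⟩
      exact (toCokernel_eq_zero (p := p) (n := n) (N := N) (m := ψ g)).2 ⟨_, (hψ g).symm⟩
    · rintro _ ⟨⟨m, hm⟩, hm0, rfl⟩
      obtain ⟨g, hg, hgm⟩ := exists_homogeneous_preimage h𝒩 hm hm0
      exact ⟨fun v => ⟨g v, hg v⟩, (hψ _).trans hgm⟩
  have h1 := LinearMap.finrank_range_add_finrank_ker (toCokernel p n N ∘ₗ (𝒩 i).subtype)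
  have h2 := LinearMap.finrank_range_of_inj hinj
  rw [hrange, Submodule.finrank_map_subtype_eq, Module.finrank_pi_fintype] at h2
  rw [h2, LinearMap.range_comp, Submodule.range_subtype] at h1
  exact h1.symm

end Counting

/-! ## Laurent series -/

theorem gPoly_eq (p n : ℕ) :
    gPoly p n = 1 - ∑ v : Fin n → Fin p, Polynomial.X ^ boxDegree v := by
  rw [gPoly, Finset.sum_range, Fintype.sum_pow, Finset.mul_sum]
  congr 1
  refine Finset.sum_congr rfl fun v _ => ?_
  rw [Finset.prod_pow_eq_pow_sum, boxDegree, pow_succ']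

theorem laurentToSeries_coeff (a : ℤ[T;T⁻¹]) (i : ℤ) : (laurentToSeries a).coeff i = a.coeff i := by
  rw [laurentToSeries, HahnSeries.coeff_sum]
  refine (Finset.sum_eq_single i (fun j _ hj => HahnSeries.coeff_single_of_ne hj.symm)
    fun h => ?_).trans (HahnSeries.coeff_single_same _ _)
  rw [HahnSeries.coeff_single_same, Finsupp.notMem_support_iff.1 h]

theorem exists_laurentPolynomial (k0 : ℤ) (q : ℤ[X]) :
    ∃ a : ℤ[T;T⁻¹], laurentToSeries a = HahnSeries.single k0 1 * polyToSeries q ∧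
      ∑ i ∈ a.coeff.support, a.coeff i = q.eval 1 := by
  let e : ℕ ↪ ℤ := ⟨fun m => k0 + m, fun m m' h => by simpa using h⟩
  refine ⟨AddMonoidAlgebra.ofCoeff (q.toFinsupp.coeff.embDomain e), ?_, ?_⟩
  · ext i
    rw [laurentToSeries_coeff, AddMonoidAlgebra.coeff_ofCoeff, HahnSeries.coeff_single_mul, one_mul,
      polyToSeries, PowerSeries.coeff_coe]
    split_ifs with h
    · refine Finsupp.embDomain_of_notMem_range _ _ _ ?_
      rintro ⟨m, rfl⟩
      change k0 + m - k0 < 0 at h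
      lia
    · have hi : i = e (i - k0).natAbs := by
        change i = k0 + ((i - k0).natAbs : ℕ)
        lia
      rw [Polynomial.coeff_coe]
      conv_lhs => rw [hi]
      rw [Finsupp.embDomain_apply_self]
      rfl
  · rw [AddMonoidAlgebra.coeff_ofCoeff, Finsupp.support_embDomain, Finset.sum_map]
    simp only [Finsupp.embDomain_apply_self]
    rw [Polynomial.eval_eq_sum]
    simp only [one_pow, mul_one]
    rfl

theorem coeff_mul_polyToSeries_eq_zero {H : LaurentSeries ℤ} {k : ℤ} (hH : ∀ i < k, H.coeff i = 0)
    (q : ℤ[X]) {i : ℤ} (hi : i < k) : (H * polyToSeries q).coeff i = 0 := by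
  rw [HahnSeries.coeff_mul]
  refine Finset.sum_eq_zero fun jl hjl => ?_
  rw [Finset.mem_antidiagonal] at hjl
  obtain ⟨-, -, h⟩ := hjl
  rcases lt_or_ge jl.1 k with h1 | h1
  · rw [hH _ h1, zero_mul]
  · rw [polyToSeries, PowerSeries.coeff_coe, if_pos (by lia), mul_zero]

/-- The Hilbert series of a graded vector space with finite-dimensional components that vanish in
degrees below `k0`. -/
theorem isHilbertSeries_single_mul {p : ℕ} [Fact p.Prime] {N : Type*} [AddCommGroup N]
    [Module (ZMod p) N] {𝒩 : ℤ → Submodule (ZMod p) N}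
    (hfin : ∀ i, FiniteDimensional (ZMod p) (𝒩 i)) {k0 : ℤ} (hk0 : ∀ i < k0, 𝒩 i = ⊥) :
    IsHilbertSeries 𝒩 (HahnSeries.single k0 1 *
      ((PowerSeries.mk fun m : ℕ => (hilbertFunction 𝒩 (k0 + m) : ℤ)) : LaurentSeries ℤ)) := by
  refine ⟨hfin, fun i => ?_⟩
  rw [HahnSeries.coeff_single_mul, one_mul, PowerSeries.coeff_coe]
  split_ifs with h
  · rw [hk0 i (by lia), finrank_bot, Nat.cast_zero]
  · rw [PowerSeries.coeff_mk, Int.natAbs_of_nonneg (by lia), add_sub_cancel]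
    rfl

/-! ### The numerator of the Hilbert series of N -/

section Numerator

variable {p n : ℕ} [Fact p.Prime] {N : Type*} [AddCommGroup N] [Module (A p n) N]
  [Module (ZMod p) N] [IsScalarTower (ZMod p) (A p n) N] {𝒩 : ℤ → Submodule (ZMod p) N}

/-- The coefficients of the product are the differences in `exists_hilbertFunction_eq`, so the two
series disagree in finitely many degrees only. -/
theorem exists_gPoly_mul_eq (h𝒩 : IsGradedModule p n N 𝒩)
    (hN : Module.FinitePresentation (A p n) N) {k0 : ℤ} (hk0 : ∀ i < k0, 𝒩 i = ⊥) :
    ∃ q : ℤ[X], (gPoly p n : ℤ⟦X⟧) * PowerSeries.mk (fun m : ℕ => (hilbertFunction 𝒩 (k0 + m) : ℤ)) =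
      PowerSeries.mk (fun m : ℕ =>
        (hilbertFunction (cokernelGrading (n := n) 𝒩) (k0 + m) : ℤ)) + (q : ℤ⟦X⟧) := by
  obtain ⟨I, hI⟩ := exists_hilbertFunction_eq h𝒩 hN
  have hzero : ∀ i < k0, hilbertFunction 𝒩 i = 0 := fun i hi => by
    rw [hilbertFunction, hk0 i hi, finrank_bot]
  have hcoeff : ∀ m : ℕ, PowerSeries.coeff m ((gPoly p n : ℤ⟦X⟧) *
      PowerSeries.mk (fun m : ℕ => (hilbertFunction 𝒩 (k0 + m) : ℤ))) =
      hilbertFunction 𝒩 (k0 + m) -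
        ∑ v : Fin n → Fin p, (hilbertFunction 𝒩 (k0 + m - boxDegree v) : ℤ) := by
    intro m
    have hcoe : ((∑ v : Fin n → Fin p, Polynomial.X ^ boxDegree v : ℤ[X]) : ℤ⟦X⟧) =
        ∑ v : Fin n → Fin p, PowerSeries.X ^ boxDegree v := by
      rw [← Polynomial.coeToPowerSeries.ringHom_apply, map_sum]
      simp
    rw [gPoly_eq, Polynomial.coe_sub, Polynomial.coe_one, hcoe, sub_mul, one_mul, Finset.sum_mul,
      map_sub, map_sum, PowerSeries.coeff_mk]
    congr 1
    refine Finset.sum_congr rfl fun v _ => ?_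
    rw [PowerSeries.coeff_X_pow_mul']
    split_ifs with h
    · rw [PowerSeries.coeff_mk, Nat.cast_sub h, add_sub_assoc]
    · rw [hzero _ (by lia), Nat.cast_zero]
  obtain ⟨q, hq⟩ := exists_polynomial_of_eventually_zero
    (h := fun m : ℕ => PowerSeries.coeff m ((gPoly p n : ℤ⟦X⟧) *
      PowerSeries.mk (fun m : ℕ => (hilbertFunction 𝒩 (k0 + m) : ℤ))) -
      hilbertFunction (cokernelGrading (n := n) 𝒩) (k0 + m)) (M := (I - k0).toNat) fun m hm => by
        rw [hcoeff, hI (k0 + m) (by lia)]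
        push_cast
        ring
  refine ⟨q, ?_⟩
  rw [← hq]
  ext m
  simp

theorem exists_numerator (h𝒩 : IsGradedModule p n N 𝒩)
    (hN : Module.FinitePresentation (A p n) N) {k0 : ℤ} (hk0 : ∀ i < k0, 𝒩 i = ⊥) :
    ∃ d ≤ n, IsDimCokernel p n N d ∧ ∃ q : ℤ[X],
      ((((1 - Polynomial.X) ^ d * gPoly p n : ℤ[X])) : ℤ⟦X⟧) *
        PowerSeries.mk (fun m : ℕ => (hilbertFunction 𝒩 (k0 + m) : ℤ)) = (q : ℤ⟦X⟧) ∧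
      (0 < d → 0 < q.eval 1) := by
  have : Module.Finite (A p n) N := inferInstance
  have := finite_structuralCokernel (p := p) (n := n) (N := N)
  obtain ⟨q, hq⟩ := exists_gPoly_mul_eq h𝒩 hN hk0
  rcases subsingleton_or_nontrivial (StructuralCokernel p n N) with hC | hC
  -- A zero cokernel has support dimension `⊥`, read as d = 0, and positivity is then vacuous.
  · refine ⟨0, Nat.zero_le _, ?_, q, ?_, fun h => absurd h (lt_irrefl 0)⟩
    · rw [IsDimCokernel, Module.supportDim_eq_bot_of_subsingleton]
      rfl
    · rw [pow_zero, one_mul, hq, add_eq_right]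
      ext m
      have h0 : cokernelGrading (n := n) 𝒩 (k0 + m) = ⊥ := Subsingleton.elim _ _
      rw [PowerSeries.coeff_mk, hilbertFunction, h0, finrank_bot, Nat.cast_zero, map_zero]
  · have hint : DirectSum.IsInternal (cokernelGrading (p := p) (n := n) 𝒩) :=
      isInternal_cokernelGrading h𝒩
    have hX := mulX_mem_cokernelGrading (p := p) (n := n) (N := N) h𝒩
    have hbot : ∀ i < k0, cokernelGrading (p := p) (n := n) 𝒩 i = ⊥ := fun i hi => by
      rw [cokernelGrading, hk0 i hi, Submodule.map_bot]
    obtain ⟨d, hd, hdim, b, hb, hb1⟩ := exists_hilbert_numerator (n := n) (k := ZMod p)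
      (C := StructuralCokernel p n N) (𝒢 := cokernelGrading (p := p) (n := n) 𝒩) hint hX hbot
    refine ⟨d, hd, ?_, b + (1 - Polynomial.X) ^ d * q, ?_, fun h => ?_⟩
    · rw [IsDimCokernel, hdim]
      rfl
    · push_cast
      rw [mul_assoc, hq, mul_add, ← hb]
      rfl
    · rw [Polynomial.eval_add, Polynomial.eval_mul, Polynomial.eval_pow, Polynomial.eval_sub,
        Polynomial.eval_one, Polynomial.eval_X, sub_self, zero_pow h.ne', zero_mul, add_zero]
      exact hb1

end Numerator

end FrobGr

end

theorem theorem3p21 (p n : ℕ) [Fact p.Prime]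
    (N : Type*) [AddCommGroup N] [Module (FrobGr.A p n) N]
    [Module (ZMod p) N] [IsScalarTower (ZMod p) (FrobGr.A p n) N]
    (𝒩 : ℤ → Submodule (ZMod p) N) (h𝒩 : FrobGr.IsGradedModule p n N 𝒩)
    (hN : Module.FinitePresentation (FrobGr.A p n) N) :
    ∃ (H : LaurentSeries ℤ) (d : ℕ) (a : LaurentPolynomial ℤ),
      FrobGr.IsHilbertSeries 𝒩 H ∧
      FrobGr.IsDimCokernel p n N d ∧ d ≤ n ∧
      H * FrobGr.polyToSeries ((1 - Polynomial.X) ^ d * FrobGr.gPoly p n) =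
        FrobGr.laurentToSeries a ∧
      (∀ k : ℤ, (∀ i < k, 𝒩 i = ⊥) → ∀ i < k, a.coeff i = 0) ∧
      (0 < d → 0 < ∑ i ∈ a.coeff.support, a.coeff i) := by
  obtain ⟨⟨k0, hk0⟩, hfin⟩ := FrobGr.bddBelow_and_finite h𝒩
  obtain ⟨d, hd, hdim, q, hq, hq1⟩ := FrobGr.exists_numerator h𝒩 hN hk0
  obtain ⟨a, ha, ha1⟩ := FrobGr.exists_laurentPolynomial k0 q
  set H : LaurentSeries ℤ := HahnSeries.single k0 1 * HahnSeries.ofPowerSeries ℤ ℤ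
    (PowerSeries.mk fun m => (FrobGr.hilbertFunction 𝒩 (k0 + m) : ℤ)) with hHdef
  have hH : FrobGr.IsHilbertSeries 𝒩 H := FrobGr.isHilbertSeries_single_mul hfin hk0
  have hHa : H * FrobGr.polyToSeries ((1 - Polynomial.X) ^ d * FrobGr.gPoly p n) =
      FrobGr.laurentToSeries a := by
    rw [ha, hHdef, mul_assoc]
    congr 1
    rw [FrobGr.polyToSeries, FrobGr.polyToSeries, ← hq, PowerSeries.coe_mul, mul_comm]
  refine ⟨H, d, a, hH, hdim, hd, hHa, fun k hk i hi => ?_, fun h => ?_⟩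
  · rw [← FrobGr.laurentToSeries_coeff, ← hHa]
    -- Any bound k works, not only the chosen `k0`: a factor without negative powers cannot lower
    -- the order of H.
    refine FrobGr.coeff_mul_polyToSeries_eq_zero (fun j hj => ?_) _ hi
    rw [hH.coeff_eq, hk j hj, finrank_bot, Nat.cast_zero]
  · rw [ha1]
    exact hq1 h
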